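/- Let ${}^*\mathbb{R}$ be the ultrapower of $\mathbb{R}$ modulo an arbitrary ultrafilter; *internal* functions and sets are those given by (classes of) families of real functions and of sets of reals. A hyperreal $x$ is *infinitesimal* if $|x|<\varepsilon$ for every standard real $\varepsilon>0$ and *limited* if $|x|\le C$ for some standard $C$; $x\simeq y$ means that $x-y$ is infinitesimal. Let $a,b$ be standard reals and let $\mathfrak{T}=\{a=t_0<t_1<\dots<t_\nu=b\}$ be a near interval: an internal sequence, $\nu$ a hypernatural number, with all steps $t_{i+1}-t_i$ infinitesimal. For an internal set $A$ and an internal function $f:\mathfrak{T}\to{}^*\mathbb{R}$ put $\int_A f\,dm=\sum_{i<\nu,\ t_i\in A}f(t_i)(t_{i+1}-t_i)$ and $m(A)=\int_A 1\,dm$. Call - $f$ *$S$-integrable* if for all hyperreals $a\le c\le d\le b$ the integral $\int_{[c,d[}|f|\,dm$ is limited, and infinitesimal whenever $d-c$ is infinitesimal; - $f$ *absolutely $S$-integrable* if $\int_{\mathfrak{T}}|f|\,dm$ is limited and $\int_A|f|\,dm$ is infinitesimal for every internal set $A$ with $m(A)$ infinitesimal (this implies $S$-integrability); - a possibly external set $R\subseteq\mathfrak{T}$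 *rare* if for every standard $\alpha>0$ there is an internal $B\supseteq R$ with $m(B)\le\alpha$; - $f$ *almost continuous* if there is a rare $R$ such that $f(s)\simeq f(t)$ for all $s,t\in\mathfrak{T}\setminus R$ with $s\simeq t$; and *Lebesgue integrable* if it is $S$-integrable and almost continuous; - an internal set $A$ *quadrable* if its boundary, the set of points of $\mathfrak{T}$ that are infinitely close both to a point of $\mathfrak{T}\cap A$ and to a point of $\mathfrak{T}\setminus A$, is rare; - $h$ *quickly fluctuating* if it is $S$-integrable and $\int_A h\,dm$ is infinitesimal for every quadrable $A$. **Theorem (Cartier–Perrin).** Let $f$ be an $S$-integrable internal function on $\mathfrak{T}$. 1. There are internal functions $f_{\rm trend}$, Lebesgue integrable, and $f_{\rm fluctuation}$, quickly fluctuating, with $f=f_{\rm trend}+f_{\rm fluctuation}$ on $\mathfrak{T}$. If $f$ is absolutely $S$-integrable, both can moreover be chosen absolutely $S$-integrable. 2. The decomposition with absolutely $S$-integrable trend is unique up to an infinitesimal: if $f=g+h=g'+h'$ are two decompositions as in 1 and $g,g'$ are absolutely $S$-integrable, then $g\simeq g'$ and $h\simeq h'$ outside a rare subset of $\mathfrak{T}$,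 and $\int_{\mathfrak{T}}|g-g'|\,dm$ and $\int_{\mathfrak{T}}|h-h'|\,dm$ are infinitesimal. -/

import Mathlib

open Filter

noncomputable section

namespace CartierPerrin

/-- The ultrapower `*α` of `α` modulo the ultrafilter `U`. Elements of `*(Set ℝ)` are the internal
sets of hyperreals, elements of `*(α → β)` are the internal functions from `*α` to `*β`. -/
abbrev Ultrapower {I : Type*} (U : Ultrafilter I) (α : Type*) : Type _ := Germ (U : Filter I) α

/-- The value at `x` of the internal function `f`. -/
def app {I α β : Type*} {U : Ultrafilter I} (f : Ultrapower U (α → β)) (x : Ultrapower U α) :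
    Ultrapower U β :=
  Germ.map₂ (fun g y => g y) f x

/-- The point `x` belongs to the internal set `A`. -/
def InternalMem {I α : Type*} {U : Ultrafilter I} (x : Ultrapower U α)
    (A : Ultrapower U (Set α)) : Prop :=
  Germ.LiftRel (fun y B => y ∈ B) x A

/-- The hyperreal `x` is infinitesimal. -/
def Infinitesimal {I : Type*} {U : Ultrafilter I} (x : Ultrapower U ℝ) : Prop :=
  ∀ ε : ℝ, 0 < ε → |x| < (ε : Ultrapower U ℝ)

/-- The hyperreal `x` is limited. -/
def Limited {I : Type*} {U : Ultrafilter I} (x : Ultrapower U ℝ) : Prop :=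
  ∃ C : ℝ, |x| ≤ (C : Ultrapower U ℝ)

/-- `x ≃ y`: the difference is infinitesimal. -/
def InfClose {I : Type*} {U : Ultrafilter I} (x y : Ultrapower U ℝ) : Prop :=
  Infinitesimal (x - y)

/-- The internal function `x ↦ |f x|`. -/
def absFun {I : Type*} {U : Ultrafilter I} (f : Ultrapower U (ℝ → ℝ)) : Ultrapower U (ℝ → ℝ) :=
  Germ.map (fun g x => |g x|) f

/-- A near interval with standard extremities `a` and `b`: an internal hyperfinite sequence
`a = t₀ < t₁ < ⋯ < t_ν = b` (with `ν` a hypernatural number) whose steps are all infinitesimal. -/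
structure NearInterval {I : Type*} (U : Ultrafilter I) (a b : ℝ) where
  ν : Ultrapower U ℕ
  t : Ultrapower U (ℕ → ℝ)
  t_zero : app t 0 = (a : Ultrapower U ℝ)
  t_last : app t ν = (b : Ultrapower U ℝ)
  t_lt : ∀ i : Ultrapower U ℕ, i < ν → app t i < app t (i + 1)
  t_step : ∀ i : Ultrapower U ℕ, i < ν → Infinitesimal (app t (i + 1) - app t i)

namespace NearInterval

/-- The set of points `t₀, …, t_ν`. -/
def points {I : Type*} {U : Ultrafilter I} {a b : ℝ} (T : NearInterval U a b) :
    Set (Ultrapower U ℝ) :=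
  {x | ∃ i : Ultrapower U ℕ, i ≤ T.ν ∧ x = app T.t i}

/-- The finite sum of `f (t i) * (t (i + 1) - t i)` over the `i < n` with `t i ∈ A`. -/
def finiteSum (n : ℕ) (t : ℕ → ℝ) (A : Set ℝ) (f : ℝ → ℝ) : ℝ :=
  ∑ i ∈ Finset.range n, A.indicator f (t i) * (t (i + 1) - t i)

/-- The integral `∫_A f dm`: the hyperfinite sum of `f (t_i) * (t_{i+1} - t_i)` over the `i < ν`
with `t_i ∈ A`. Only the trace of the internal set `A` and the restriction of the internal
function `f` to the near interval matter. -/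
def integral {I : Type*} {U : Ultrafilter I} {a b : ℝ} (T : NearInterval U a b)
    (A : Ultrapower U (Set ℝ)) (f : Ultrapower U (ℝ → ℝ)) : Ultrapower U ℝ :=
  app (app (app (Germ.map finiteSum T.ν) T.t) A) f

/-- The Lebesgue measure `m(A)` of (the trace of) an internal set. -/
def measure {I : Type*} {U : Ultrafilter I} {a b : ℝ} (T : NearInterval U a b)
    (A : Ultrapower U (Set ℝ)) : Ultrapower U ℝ :=
  T.integral A ((fun _ => 1 : ℝ → ℝ) : Ultrapower U (ℝ → ℝ))

/-- The integral over the whole near interval. -/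
def totalIntegral {I : Type*} {U : Ultrafilter I} {a b : ℝ} (T : NearInterval U a b)
    (f : Ultrapower U (ℝ → ℝ)) : Ultrapower U ℝ :=
  T.integral ((Set.univ : Set ℝ) : Ultrapower U (Set ℝ)) f

/-- `S`-integrability, tested on intervals `[c, d[` with hyperreal extremities. -/
def SIntegrable {I : Type*} {U : Ultrafilter I} {a b : ℝ} (T : NearInterval U a b)
    (f : Ultrapower U (ℝ → ℝ)) : Prop :=
  ∀ c d : Ultrapower U ℝ, (a : Ultrapower U ℝ) ≤ c → c ≤ d → d ≤ (b : Ultrapower U ℝ) →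
    Limited (T.integral (Germ.map₂ Set.Ico c d) (absFun f)) ∧
    (Infinitesimal (d - c) → Infinitesimal (T.integral (Germ.map₂ Set.Ico c d) (absFun f)))

/-- Absolute `S`-integrability: smallness is tested on all internal sets of infinitesimal
measure, not on intervals only. -/
def AbsolutelySIntegrable {I : Type*} {U : Ultrafilter I} {a b : ℝ} (T : NearInterval U a b)
    (f : Ultrapower U (ℝ → ℝ)) : Prop :=
  Limited (T.totalIntegral (absFun f)) ∧
  ∀ A : Ultrapower U (Set ℝ), Infinitesimal (T.measure A) →
    Infinitesimal (T.integral A (absFun f))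

/-- A possibly external set `R` is rare if for each standard `α > 0` it is covered by an internal
set of measure at most `α`. -/
def Rare {I : Type*} {U : Ultrafilter I} {a b : ℝ} (T : NearInterval U a b)
    (R : Set (Ultrapower U ℝ)) : Prop :=
  ∀ α : ℝ, 0 < α → ∃ B : Ultrapower U (Set ℝ),
    (∀ x ∈ R, InternalMem x B) ∧ T.measure B ≤ (α : Ultrapower U ℝ)

/-- `f` is `S`-continuous on the set `X`: infinitely close points of `X` have infinitely close
values. -/
def SContinuousOn {I : Type*} {U : Ultrafilter I}
    (f : Ultrapower U (ℝ → ℝ)) (X : Set (Ultrapower U ℝ)) : Prop :=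
  ∀ x ∈ X, ∀ y ∈ X, InfClose x y → InfClose (app f x) (app f y)

/-- `f` is `S`-continuous on the complement of a rare subset of the near interval. -/
def AlmostContinuous {I : Type*} {U : Ultrafilter I} {a b : ℝ} (T : NearInterval U a b)
    (f : Ultrapower U (ℝ → ℝ)) : Prop :=
  ∃ R ⊆ T.points, T.Rare R ∧ SContinuousOn f (T.points \ R)

/-- Lebesgue integrable in the nonstandard sense. -/
def LebesgueIntegrable {I : Type*} {U : Ultrafilter I} {a b : ℝ} (T : NearInterval U a b)
    (f : Ultrapower U (ℝ → ℝ)) : Prop :=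
  T.SIntegrable f ∧ T.AlmostContinuous f

/-- The boundary in the near interval of the internal set `A`: the points infinitely close both to
a point of the near interval in `A` and to one outside `A`. -/
def boundary {I : Type*} {U : Ultrafilter I} {a b : ℝ} (T : NearInterval U a b)
    (A : Ultrapower U (Set ℝ)) : Set (Ultrapower U ℝ) :=
  {x | x ∈ T.points ∧ (∃ y ∈ T.points, InfClose x y ∧ InternalMem y A) ∧
    ∃ z ∈ T.points, InfClose x z ∧ ¬ InternalMem z A}

/-- An internal set is quadrable if its boundary is rare. -/
def Quadrable {I : Type*} {U : Ultrafilter I} {a b : ℝ} (T : NearInterval U a b)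
    (A : Ultrapower U (Set ℝ)) : Prop :=
  T.Rare (T.boundary A)

/-- Quickly fluctuating functions. -/
def QuicklyFluctuating {I : Type*} {U : Ultrafilter I} {a b : ℝ} (T : NearInterval U a b)
    (h : Ultrapower U (ℝ → ℝ)) : Prop :=
  T.SIntegrable h ∧ ∀ A : Ultrapower U (Set ℝ), T.Quadrable A → Infinitesimal (T.integral A h)

/-- `f = g + h` on the near interval, with `g` Lebesgue integrable and `h` quickly fluctuating. -/
def IsDecomposition {I : Type*} {U : Ultrafilter I} {a b : ℝ} (T : NearInterval U a b)
    (f g h : Ultrapower U (ℝ → ℝ)) : Prop :=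
  (∀ x ∈ T.points, app f x = app g x + app h x) ∧
    T.LebesgueIntegrable g ∧ T.QuicklyFluctuating h

end NearInterval

end CartierPerrin

end

/-!
All internal objects are handled through families of representatives, indexed by `I`: being
infinitesimal, limited, of small measure and so on become statements that hold eventually along
`U`. If the near interval has more than one point, then its first step is a positive infinitesimal,
so there is a family of natural numbers that tends to infinity along `U`, and overspill
(`exists_tendsto_of_forall_eventually`) holds for an arbitrary ultrafilter. If it is a single point,
then every integral vanishes and there is nothing to prove.

*Existence.* Write `f = f₁ + f₂`, where `f₁` is the truncation of `f` at an infinite level.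
If the level grows slowly enough, then `f₁` is uniformly integrable
(`exists_smallTails_truncation`), hence absolutely `S`-integrable. The rest `f₂` is supported on an
internal set of infinitesimal measure, hence almost continuous, and goes into the trend.
Let `E k f₁` be the function obtained by averaging `f₁` over the dyadic cells of length `2⁻ᵏ`.
The integral of `√(1 + (E k f₁)²)` increases with `k` and stays limited, so for a suitable
infinite `N` its value at `N` exceeds its values at large standard `k` by arbitrarily little. By
strict convexity, `E k f₁` is then close in measure to `E N f₁` (`exists_almostUniform_avg`), and as
`E k f₁` is locally constant away from finitely many standard points, `E N f₁` is almost continuous.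
Finally `f₁ - E N f₁` has integral zero over unions of `N`-cells, and a quadrable set is such a union
up to an infinitesimal measure
(`AbsolutelySIntegrable.quicklyFluctuating`). The decomposition is
`f = (E N f₁ + f₂) + (f₁ - E N f₁)`.

*Uniqueness.* The difference `u` of two trends is absolutely `S`-integrable, almost continuous and
quickly fluctuating. It is close in mean to a function that is constant on the cells of some
standard level; the sets where this function is positive or negative are quadrable, so the integral
of `|u|` is infinitesimal
(`AbsolutelySIntegrable.eventually_sum_abs_le_of_almostUniform`).
-/

noncomputable section

namespace CartierPerrin

/-! ### Riemann sums over a finite subdivision -/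

/-- The left Riemann sum of `F` over the subdivision `t 0, …, t n`. Since
`finiteSum n t A f = riemannSum n t (A.indicator f)` holds by definition, sets are always treated
through their indicator functions. -/
def riemannSum (n : ℕ) (t : ℕ → ℝ) (F : ℝ → ℝ) : ℝ :=
  ∑ j ∈ Finset.range n, F (t j) * (t (j + 1) - t j)

section riemannSum

variable {n : ℕ} {t : ℕ → ℝ} {F G : ℝ → ℝ}

theorem riemannSum_add (n : ℕ) (t : ℕ → ℝ) (F G : ℝ → ℝ) :
    riemannSum n t (fun x => F x + G x) = riemannSum n t F + riemannSum n t G := by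
  simp only [riemannSum, add_mul, Finset.sum_add_distrib]

theorem riemannSum_sub (n : ℕ) (t : ℕ → ℝ) (F G : ℝ → ℝ) :
    riemannSum n t (fun x => F x - G x) = riemannSum n t F - riemannSum n t G := by
  simp only [riemannSum, sub_mul, Finset.sum_sub_distrib]

theorem riemannSum_const_mul (n : ℕ) (t : ℕ → ℝ) (c : ℝ) (F : ℝ → ℝ) :
    riemannSum n t (fun x => c * F x) = c * riemannSum n t F := by
  simp only [riemannSum, mul_assoc, Finset.mul_sum]

theorem riemannSum_sum {ι : Type*} (s : Finset ι) (n : ℕ) (t : ℕ → ℝ) (F : ι → ℝ → ℝ) :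
    riemannSum n t (fun x => ∑ k ∈ s, F k x) = ∑ k ∈ s, riemannSum n t (F k) := by
  simp only [riemannSum, Finset.sum_mul]
  exact Finset.sum_comm

theorem riemannSum_const (n : ℕ) (t : ℕ → ℝ) (c : ℝ) :
    riemannSum n t (fun _ => c) = c * (t n - t 0) := by
  rw [riemannSum, ← Finset.mul_sum, Finset.sum_range_sub]

theorem riemannSum_congr (h : ∀ j < n, F (t j) = G (t j)) :
    riemannSum n t F = riemannSum n t G :=
  Finset.sum_congr rfl fun j hj => by rw [h j (Finset.mem_range.1 hj)]

theorem riemannSum_mono (ht : ∀ j < n, t j ≤ t (j + 1)) (h : ∀ j < n, F (t j) ≤ G (t j)) :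
    riemannSum n t F ≤ riemannSum n t G :=
  Finset.sum_le_sum fun j hj => mul_le_mul_of_nonneg_right (h j (Finset.mem_range.1 hj))
    (sub_nonneg.2 (ht j (Finset.mem_range.1 hj)))

theorem riemannSum_nonneg (ht : ∀ j < n, t j ≤ t (j + 1)) (h : ∀ j < n, 0 ≤ F (t j)) :
    0 ≤ riemannSum n t F :=
  Finset.sum_nonneg fun j hj => mul_nonneg (h j (Finset.mem_range.1 hj))
    (sub_nonneg.2 (ht j (Finset.mem_range.1 hj)))

theorem abs_riemannSum_le (ht : ∀ j < n, t j ≤ t (j + 1)) (h : ∀ j < n, |F (t j)| ≤ G (t j)) :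
    |riemannSum n t F| ≤ riemannSum n t G := by
  rw [abs_le]
  constructor
  · have := riemannSum_mono (F := fun x => (-1) * G x) (G := F) ht
      fun j hj => by linarith [(abs_le.1 (h j hj)).1]
    rw [riemannSum_const_mul] at this
    linarith
  · exact riemannSum_mono ht fun j hj => (abs_le.1 (h j hj)).2

/-- The clamped identity `x ↦ max c (min x (d + s))` increases by at least the length of each step
that starts in `[c, d]`, and by at most `d + s - c` in total. -/
theorem riemannSum_indicator_Icc_le {c d s : ℝ} (ht : ∀ j < n, t j ≤ t (j + 1))
    (hs : ∀ j < n, t (j + 1) - t j ≤ s) (hs0 : 0 ≤ s) (hcd : c ≤ d) :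
    riemannSum n t ((Set.Icc c d).indicator 1) ≤ d - c + s := by
  set φ : ℝ → ℝ := fun x => max c (min x (d + s)) with hφ
  have hmono : Monotone φ := fun x y h => max_le_max le_rfl (min_le_min h le_rfl)
  have key : riemannSum n t ((Set.Icc c d).indicator 1)
      ≤ ∑ j ∈ Finset.range n, (φ (t (j + 1)) - φ (t j)) := by
    refine Finset.sum_le_sum fun j hj => ?_
    rw [Finset.mem_range] at hj
    have h1 := ht j hj
    have h2 := hs j hj
    by_cases h : t j ∈ Set.Icc c d
    · rw [Set.indicator_of_mem h, Pi.one_apply, one_mul]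
      obtain ⟨h3, h4⟩ := h
      simp only [hφ]
      rw [min_eq_left (by linarith), min_eq_left (by linarith), max_eq_right (by linarith),
        max_eq_right h3]
    · rw [Set.indicator_of_notMem h, zero_mul]
      exact sub_nonneg.2 (hmono h1)
  rw [Finset.sum_range_sub fun j => φ (t j)] at key
  have h1 : φ (t n) ≤ d + s := max_le (by linarith) (min_le_right _ _)
  have h2 : c ≤ φ (t 0) := le_max_left _ _
  linarith

end riemannSum

/-! ### Dyadic cells and averages over them -/

/-- The index of the half-open dyadic interval of length `2⁻ᵏ` that contains `x`. -/
def cell (k : ℕ) (x : ℝ) : ℤ := ⌊(2 : ℝ) ^ k * x⌋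

theorem cell_eq_div {k l : ℕ} (h : k ≤ l) (x : ℝ) :
    cell k x = cell l x / ((2 ^ (l - k) : ℕ) : ℤ) := by
  rw [cell, cell, ← Int.floor_div_natCast]
  congr 1
  have : (2 : ℝ) ^ l = 2 ^ (l - k) * 2 ^ k := by rw [← pow_add, Nat.sub_add_cancel h]
  push_cast
  rw [this]
  field_simp

theorem abs_sub_le_of_cell_eq {k : ℕ} {x y : ℝ} (h : cell k x = cell k y) :
    |x - y| ≤ (1 / 2) ^ k := by
  have h1 := Int.abs_sub_lt_one_of_floor_eq_floor h
  rw [← mul_sub, abs_mul, abs_of_pos (by positivity)] at h1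
  rw [one_div, inv_pow]
  rw [← one_div, le_div_iff₀ (by positivity)]
  linarith

/-- The points at distance at most `2⁻ᵏ δ` from the dyadic numbers of level `k`. -/
def nearDyadic (k : ℕ) (δ : ℝ) : Set ℝ := {x | ∃ c : ℤ, |2 ^ k * x - c| ≤ δ}

/-- Two points in different cells are separated by a dyadic number, which is close to both of them
if they are close to each other. -/
theorem exists_int_of_cell_ne {k : ℕ} {x y : ℝ} (h : cell k x ≠ cell k y) :
    ∃ c : ℤ, |2 ^ k * x - c| ≤ 2 ^ k * |x - y| := by
  have e : (2 : ℝ) ^ k * |x - y| = |2 ^ k * x - 2 ^ k * y| := by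
    rw [← mul_sub, abs_mul, abs_of_pos (a := (2 : ℝ) ^ k) (by positivity)]
  rw [e]
  rcases lt_or_gt_of_ne h with h | h
  · refine ⟨cell k y, ?_⟩
    have h1 : (2 : ℝ) ^ k * x < cell k y := Int.floor_lt.1 h
    have h2 : (cell k y : ℝ) ≤ 2 ^ k * y := Int.floor_le _
    rw [abs_of_nonpos (by linarith), abs_of_nonpos (by linarith)]
    linarith
  · refine ⟨cell k x, ?_⟩
    have h1 : (2 : ℝ) ^ k * y < cell k x := Int.floor_lt.1 h
    have h2 : (cell k x : ℝ) ≤ 2 ^ k * x := Int.floor_le _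
    rw [abs_of_nonneg (by linarith), abs_of_nonneg (by linarith)]
    linarith

theorem riemannSum_indicator_nearDyadic_le {n : ℕ} {t : ℕ → ℝ} {a b δ s : ℝ} (k : ℕ)
    (ht : ∀ j < n, t j ≤ t (j + 1)) (hab : ∀ j < n, t j ∈ Set.Icc a b)
    (hs : ∀ j < n, t (j + 1) - t j ≤ s) (hs0 : 0 ≤ s) (hδ0 : 0 ≤ δ) (hδ1 : δ ≤ 1) :
    riemannSum n t ((nearDyadic k δ).indicator 1) ≤
      (Finset.Icc (⌊(2 : ℝ) ^ k * a⌋ - 1) (⌈(2 : ℝ) ^ k * b⌉ + 1)).card * (2 * δ + s) := by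
  set F := Finset.Icc (⌊(2 : ℝ) ^ k * a⌋ - 1) (⌈(2 : ℝ) ^ k * b⌉ + 1)
  have hp : (0 : ℝ) < 2 ^ k := by positivity
  let J : ℤ → Set ℝ := fun c => Set.Icc ((c - δ) / 2 ^ k) ((c + δ) / 2 ^ k)
  have h1 : riemannSum n t ((nearDyadic k δ).indicator 1) ≤
      riemannSum n t (fun x => ∑ c ∈ F, (J c).indicator 1 x) := by
    refine riemannSum_mono ht fun j hj => ?_
    have hnn : ∀ c ∈ F, 0 ≤ (J c).indicator (1 : ℝ → ℝ) (t j) := fun c _ =>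
      Set.indicator_nonneg (fun _ _ => zero_le_one) _
    by_cases h : t j ∈ nearDyadic k δ
    · obtain ⟨c, hc⟩ := h
      obtain ⟨hc1, hc2⟩ := abs_le.1 hc
      obtain ⟨ha, hb⟩ := hab j hj
      have ha' := mul_le_mul_of_nonneg_left ha hp.le
      have hb' := mul_le_mul_of_nonneg_left hb hp.le
      have hcF : c ∈ F := by
        rw [Finset.mem_Icc]
        constructor
        · have := Int.floor_le ((2 : ℝ) ^ k * a)
          rw [sub_le_iff_le_add]
          exact_mod_cast this.trans (by linarith : (2 : ℝ) ^ k * a ≤ c + 1)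
        · have := Int.le_ceil ((2 : ℝ) ^ k * b)
          exact_mod_cast (by linarith : (c : ℝ) ≤ ⌈(2 : ℝ) ^ k * b⌉ + 1)
      have hcJ : t j ∈ J c :=
        ⟨(div_le_iff₀ hp).2 (by linarith), (le_div_iff₀ hp).2 (by linarith)⟩
      rw [Set.indicator_of_mem (show t j ∈ nearDyadic k δ from ⟨c, hc⟩)]
      have := Finset.single_le_sum hnn hcF
      rwa [Set.indicator_of_mem hcJ] at this
    · rw [Set.indicator_of_notMem h]
      exact Finset.sum_nonneg hnn
  rw [riemannSum_sum] at h1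
  refine h1.trans ((Finset.sum_le_card_nsmul F _ (2 * δ + s) fun c _ => ?_).trans_eq
    (nsmul_eq_mul _ _))
  have hp1 : (1 : ℝ) ≤ 2 ^ k := one_le_pow₀ one_le_two
  refine (riemannSum_indicator_Icc_le ht hs hs0 ?_).trans ?_
  · gcongr
    linarith
  · rw [← sub_div]
    have : (c + δ - (c - δ)) / 2 ^ k ≤ 2 * δ := by
      rw [div_le_iff₀ hp]
      nlinarith
    linarith

/-- The average of `f` over the cell of level `k` and index `c`; it is `0` if the sum of the
weights of the points in the cell vanishes. -/
def cellAvg (n : ℕ) (t : ℕ → ℝ) (k : ℕ) (f : ℝ → ℝ) (c : ℤ) : ℝ :=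
  riemannSum n t ({y | cell k y = c}.indicator f) / riemannSum n t ({y | cell k y = c}.indicator 1)

/-- The conditional expectation of `f` given the cells of level `k`: the average of `f` over the
cell of `x`. -/
def condAvg (n : ℕ) (t : ℕ → ℝ) (k : ℕ) (f : ℝ → ℝ) (x : ℝ) : ℝ := cellAvg n t k f (cell k x)

section condAvg

variable {n : ℕ} {t : ℕ → ℝ}

/-- The defining property of a conditional expectation. -/
theorem riemannSum_mul_condAvg (ht : ∀ j < n, t j ≤ t (j + 1)) (k : ℕ) (f : ℝ → ℝ) (φ : ℤ → ℝ) :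
    riemannSum n t (fun x => φ (cell k x) * condAvg n t k f x) =
      riemannSum n t (fun x => φ (cell k x) * f x) := by
  set w : ℕ → ℝ := fun j => t (j + 1) - t j with hw
  set m : ℤ → ℝ := fun c => riemannSum n t ({y | cell k y = c}.indicator 1) with hm
  have e1 : ∀ j, φ (cell k (t j)) * condAvg n t k f (t j) * w j =
      ∑ l ∈ Finset.range n, (if cell k (t j) = cell k (t l) then
        φ (cell k (t l)) * f (t l) * w l / m (cell k (t l)) * w j else 0) := by
    intro j
    rw [condAvg, cellAvg, riemannSum, Finset.sum_div, Finset.mul_sum, Finset.sum_mul]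
    refine Finset.sum_congr rfl fun l _ => ?_
    by_cases h : cell k (t j) = cell k (t l)
    · rw [Set.indicator_of_mem (show t l ∈ {y | cell k y = cell k (t j)} from h.symm), if_pos h, h]
      simp only [hm, hw]
      ring
    · rw [Set.indicator_of_notMem (show t l ∉ {y | cell k y = cell k (t j)} from
        fun h' => h h'.symm), if_neg h]
      ring
  rw [riemannSum, riemannSum, Finset.sum_congr rfl fun j _ => e1 j, Finset.sum_comm]
  refine Finset.sum_congr rfl fun l hl => ?_
  have e2 : ∑ j ∈ Finset.range n, (if cell k (t j) = cell k (t l) then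
      φ (cell k (t l)) * f (t l) * w l / m (cell k (t l)) * w j else 0) =
      φ (cell k (t l)) * f (t l) * w l / m (cell k (t l)) * m (cell k (t l)) := by
    conv_rhs => rw [hm]
    simp only [riemannSum]
    rw [Finset.mul_sum]
    refine Finset.sum_congr rfl fun j _ => ?_
    by_cases h : cell k (t j) = cell k (t l)
    · rw [Set.indicator_of_mem (show t j ∈ {y | cell k y = cell k (t l)} from h), if_pos h]
      simp only [Pi.one_apply, one_mul, hm, hw, riemannSum]
    · rw [Set.indicator_of_notMem (show t j ∉ {y | cell k y = cell k (t l)} from h), if_neg h]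
      ring
  rw [e2]
  have hw0 : ∀ j ∈ Finset.range n, 0 ≤ w j := fun j hj =>
    sub_nonneg.2 (ht j (Finset.mem_range.1 hj))
  by_cases h0 : m (cell k (t l)) = 0
  -- a cell of measure zero contains only points of weight zero
  · have hle : w l ≤ m (cell k (t l)) := by
      have := Finset.single_le_sum (f := fun j =>
        ({y | cell k y = cell k (t l)}.indicator (1 : ℝ → ℝ)) (t j) * w j)
        (fun j hj => mul_nonneg (Set.indicator_nonneg (fun _ _ => zero_le_one) _) (hw0 j hj)) hl
      simpa [hm, riemannSum, Set.indicator_of_mem] using this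
    have : w l = 0 := le_antisymm (h0 ▸ hle) (hw0 l hl)
    change _ = φ (cell k (t l)) * f (t l) * w l
    rw [this, h0]
    simp
  · exact div_mul_cancel₀ _ h0

theorem riemannSum_condAvg (ht : ∀ j < n, t j ≤ t (j + 1)) (k : ℕ) (f : ℝ → ℝ) :
    riemannSum n t (condAvg n t k f) = riemannSum n t f := by
  simpa using riemannSum_mul_condAvg ht k f fun _ => 1

theorem condAvg_nonneg (ht : ∀ j < n, t j ≤ t (j + 1)) (k : ℕ) {f : ℝ → ℝ} (hf : ∀ x, 0 ≤ f x)
    (x : ℝ) : 0 ≤ condAvg n t k f x :=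
  div_nonneg (riemannSum_nonneg ht fun _ _ => Set.indicator_nonneg (fun y _ => hf y) _)
    (riemannSum_nonneg ht fun _ _ => Set.indicator_nonneg (fun _ _ => zero_le_one) _)

theorem abs_condAvg_le (ht : ∀ j < n, t j ≤ t (j + 1)) (k : ℕ) {f g : ℝ → ℝ} {M : ℝ} (hM : 0 ≤ M)
    (hfg : ∀ x, |f x| ≤ M + g x) (x : ℝ) :
    |condAvg n t k f x| ≤ M + condAvg n t k g x := by
  set c := cell k x
  set Q : Set ℝ := {y | cell k y = c}
  have hm : 0 ≤ riemannSum n t (Q.indicator 1) :=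
    riemannSum_nonneg ht fun _ _ => Set.indicator_nonneg (fun _ _ => zero_le_one) _
  have h1 : |riemannSum n t (Q.indicator f)| ≤
      M * riemannSum n t (Q.indicator 1) + riemannSum n t (Q.indicator g) := by
    rw [← riemannSum_const_mul, ← riemannSum_add]
    refine abs_riemannSum_le ht fun j _ => ?_
    by_cases h : t j ∈ Q
    · simpa [h] using hfg (t j)
    · simp [h]
  change |riemannSum n t (Q.indicator f) / _| ≤
    M + riemannSum n t (Q.indicator g) / riemannSum n t (Q.indicator 1)
  rcases hm.eq_or_lt with h0 | h0
  · rw [← h0]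
    simpa using hM
  · rw [abs_div, abs_of_pos h0, div_le_iff₀ h0, add_mul, div_mul_cancel₀ _ h0.ne']
    exact h1

theorem riemannSum_abs_condAvg_le (ht : ∀ j < n, t j ≤ t (j + 1)) (k : ℕ) (f : ℝ → ℝ) :
    riemannSum n t (fun x => |condAvg n t k f x|) ≤ riemannSum n t (fun x => |f x|) := by
  rw [← riemannSum_condAvg ht k fun x => |f x|]
  refine riemannSum_mono ht fun j _ => ?_
  simpa using abs_condAvg_le ht k le_rfl (fun x => (zero_add |f x|).symm.le) (t j)

/-- Averages over coarse and over finer cells have the same integral against a function that is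
constant on the coarse cells. -/
theorem riemannSum_mul_condAvg_sub (ht : ∀ j < n, t j ≤ t (j + 1)) {k l : ℕ} (hkl : k ≤ l)
    (f : ℝ → ℝ) (φ : ℤ → ℝ) :
    riemannSum n t (fun x => φ (cell k x) * (condAvg n t l f x - condAvg n t k f x)) = 0 := by
  simp only [mul_sub]
  rw [riemannSum_sub, riemannSum_mul_condAvg ht k f φ, sub_eq_zero]
  simp only [cell_eq_div hkl]
  exact riemannSum_mul_condAvg ht l f fun c => φ (c / ((2 ^ (l - k) : ℕ) : ℤ))

/-- The energy of the averages of level `k`, for the strictly convex function `√(1 + x²)`. The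
linear growth of this function makes the energies of all levels bounded in terms of the integral
of `|f|` alone. -/
def energy (n : ℕ) (t : ℕ → ℝ) (f : ℝ → ℝ) (k : ℕ) : ℝ :=
  riemannSum n t (fun x => √(1 + condAvg n t k f x ^ 2))

/-- The quantitative convexity of `√(1 + x²)`. -/
theorem sqrt_one_add_sq_ge (x y : ℝ) :
    √(1 + x ^ 2) + x / √(1 + x ^ 2) * (y - x) + (y - x) ^ 2 / (2 * (1 + x ^ 2) * √(1 + y ^ 2)) ≤
      √(1 + y ^ 2) := by
  set u := √(1 + x ^ 2) with hu
  set v := √(1 + y ^ 2) with hv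
  have hu0 : 0 < u := Real.sqrt_pos.2 (by positivity)
  have hv0 : 0 < v := Real.sqrt_pos.2 (by positivity)
  have hu2 : u ^ 2 = 1 + x ^ 2 := Real.sq_sqrt (by positivity)
  have hv2 : v ^ 2 = 1 + y ^ 2 := Real.sq_sqrt (by positivity)
  rw [← hu2]
  have huv : (u * v) ^ 2 - (1 + x * y) ^ 2 = (y - x) ^ 2 := by
    rw [mul_pow, hu2, hv2]; ring
  have huv0 : 0 < u * v := mul_pos hu0 hv0
  have h1 : |1 + x * y| ≤ u * v := abs_le_of_sq_le_sq (by nlinarith [sq_nonneg (y - x)]) huv0.le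
  obtain ⟨h2, h3⟩ := abs_le.1 h1
  -- `(uv)² - (1 + xy)² = (uv - (1 + xy)) (uv + (1 + xy))`, and the last factor is at most `2uv`
  have key : (y - x) ^ 2 ≤ 2 * (u * v) * (u * v - (1 + x * y)) := by
    rw [← huv]; nlinarith
  have e : v - (u + x / u * (y - x)) = (u * v - (1 + x * y)) / u := by
    field_simp
    linear_combination (-1 : ℝ) * hu2
  have : (y - x) ^ 2 / (2 * u ^ 2 * v) ≤ (u * v - (1 + x * y)) / u := by
    rw [div_le_div_iff₀ (by positivity) hu0]
    nlinarith
  linarith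

theorem energy_le (ht : ∀ j < n, t j ≤ t (j + 1)) (f : ℝ → ℝ) (k : ℕ) :
    energy n t f k ≤ (t n - t 0) + riemannSum n t (fun x => |f x|) := by
  have h : energy n t f k ≤ riemannSum n t (fun x => 1 + |condAvg n t k f x|) := by
    refine riemannSum_mono ht fun j _ => ?_
    rw [Real.sqrt_le_left (by positivity)]
    nlinarith [abs_nonneg (condAvg n t k f (t j)), sq_abs (condAvg n t k f (t j))]
  rw [riemannSum_add, riemannSum_const, one_mul] at h
  linarith [riemannSum_abs_condAvg_le ht k f]

theorem energy_nonneg (ht : ∀ j < n, t j ≤ t (j + 1)) (f : ℝ → ℝ) (k : ℕ) : 0 ≤ energy n t f k :=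
  riemannSum_nonneg ht fun _ _ => Real.sqrt_nonneg _

theorem riemannSum_sq_sub_le_energy_sub (ht : ∀ j < n, t j ≤ t (j + 1)) {k l : ℕ} (hkl : k ≤ l)
    (f : ℝ → ℝ) :
    riemannSum n t (fun x => (condAvg n t l f x - condAvg n t k f x) ^ 2 /
      (2 * (1 + condAvg n t k f x ^ 2) * √(1 + condAvg n t l f x ^ 2))) ≤
      energy n t f l - energy n t f k := by
  have h0 := riemannSum_mul_condAvg_sub ht hkl f fun c =>
    cellAvg n t k f c / √(1 + cellAvg n t k f c ^ 2)
  have h2 : riemannSum n t (fun x => √(1 + condAvg n t k f x ^ 2) +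
      condAvg n t k f x / √(1 + condAvg n t k f x ^ 2) * (condAvg n t l f x - condAvg n t k f x) +
      (condAvg n t l f x - condAvg n t k f x) ^ 2 /
        (2 * (1 + condAvg n t k f x ^ 2) * √(1 + condAvg n t l f x ^ 2))) ≤ energy n t f l :=
    riemannSum_mono ht fun _ _ => sqrt_one_add_sq_ge _ _
  rw [riemannSum_add, riemannSum_add] at h2
  change riemannSum n t (fun x => condAvg n t k f x / √(1 + condAvg n t k f x ^ 2) *
    (condAvg n t l f x - condAvg n t k f x)) = 0 at h0
  rw [h0] at h2
  change energy n t f k + 0 + _ ≤ _ at h2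
  linarith

/-- Averages whose energies are close are close in measure. The bound `r` truncates: the points
where one of the averages exceeds `r` contribute the first term. -/
theorem riemannSum_indicator_lt_le (ht : ∀ j < n, t j ≤ t (j + 1)) {k l : ℕ} (hkl : k ≤ l)
    (f : ℝ → ℝ) {ε r : ℝ} (hε : 0 < ε) (hr : 0 < r) :
    riemannSum n t ({x | ε < |condAvg n t l f x - condAvg n t k f x|}.indicator 1) ≤
      2 * riemannSum n t (fun x => |f x|) / r +
        2 * (1 + r ^ 2) ^ 2 / ε ^ 2 * (energy n t f l - energy n t f k) := by
  have h1 : riemannSum n t ({x | ε < |condAvg n t l f x - condAvg n t k f x|}.indicator 1) ≤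
      riemannSum n t (fun x => (1 / r * |condAvg n t k f x| + 1 / r * |condAvg n t l f x|) +
        2 * (1 + r ^ 2) ^ 2 / ε ^ 2 * ((condAvg n t l f x - condAvg n t k f x) ^ 2 /
          (2 * (1 + condAvg n t k f x ^ 2) * √(1 + condAvg n t l f x ^ 2)))) := by
    refine riemannSum_mono ht fun j _ => ?_
    generalize hx : condAvg n t k f (t j) = x
    generalize hy : condAvg n t l f (t j) = y
    have hp1 : 0 ≤ 1 / r * |x| := by positivity
    have hp2 : 0 ≤ 1 / r * |y| := by positivity
    have hp3 : 0 ≤ 2 * (1 + r ^ 2) ^ 2 / ε ^ 2 *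
        ((y - x) ^ 2 / (2 * (1 + x ^ 2) * √(1 + y ^ 2))) := by positivity
    by_cases h : ε < |y - x|
    · rw [Set.indicator_of_mem (by simpa [hx, hy] using h), Pi.one_apply]
      by_cases hxr : r ≤ |x|
      · have : 1 ≤ 1 / r * |x| := by rw [one_div, le_inv_mul_iff₀ hr]; linarith
        linarith
      by_cases hyr : r ≤ |y|
      · have : 1 ≤ 1 / r * |y| := by rw [one_div, le_inv_mul_iff₀ hr]; linarith
        linarith
      push Not at hxr hyr
      have hx2 : x ^ 2 ≤ r ^ 2 := sq_le_sq' (by linarith [(abs_lt.1 hxr).1]) (abs_lt.1 hxr).2.le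
      have hy2 : y ^ 2 ≤ r ^ 2 := sq_le_sq' (by linarith [(abs_lt.1 hyr).1]) (abs_lt.1 hyr).2.le
      have hs : √(1 + y ^ 2) ≤ 1 + r ^ 2 := by
        rw [Real.sqrt_le_left (by positivity)]
        nlinarith [sq_nonneg r]
      have hs0 : 0 < √(1 + y ^ 2) := Real.sqrt_pos.2 (by positivity)
      have hD : 2 * (1 + x ^ 2) * √(1 + y ^ 2) ≤ 2 * (1 + r ^ 2) ^ 2 := by
        have := mul_le_mul (add_le_add_right hx2 1) hs hs0.le (by positivity)
        nlinarith
      have hε2 : ε ^ 2 ≤ (y - x) ^ 2 := by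
        rw [← sq_abs (y - x)]
        exact pow_le_pow_left₀ hε.le h.le 2
      have : 1 ≤ 2 * (1 + r ^ 2) ^ 2 / ε ^ 2 *
          ((y - x) ^ 2 / (2 * (1 + x ^ 2) * √(1 + y ^ 2))) := by
        rw [div_mul_div_comm, le_div_iff₀ (by positivity), one_mul]
        rw [mul_comm (ε ^ 2)]
        exact mul_le_mul hD hε2 (by positivity) (by positivity)
      linarith
    · rw [Set.indicator_of_notMem (by simpa [hx, hy] using h)]
      linarith
  rw [riemannSum_add, riemannSum_add, riemannSum_const_mul, riemannSum_const_mul,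
    riemannSum_const_mul] at h1
  have h2 := riemannSum_abs_condAvg_le ht k f
  have h3 := riemannSum_abs_condAvg_le ht l f
  have h4 := mul_le_mul_of_nonneg_left (riemannSum_sq_sub_le_energy_sub ht hkl f)
    (show 0 ≤ 2 * (1 + r ^ 2) ^ 2 / ε ^ 2 by positivity)
  have h5 := mul_le_mul_of_nonneg_left h2 (show 0 ≤ 1 / r by positivity)
  have h6 := mul_le_mul_of_nonneg_left h3 (show 0 ≤ 1 / r by positivity)
  have e : 2 * riemannSum n t (fun x => |f x|) / r = 1 / r * riemannSum n t (fun x => |f x|) +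
    1 / r * riemannSum n t (fun x => |f x|) := by ring
  linarith

end condAvg

/-! ### Families of representatives, transfer and overspill -/

/-- Transfer of a universal quantifier: a property that holds along `l` for every choice of points
holds along `l` for all points at once. -/
theorem eventually_forall_of_choice {I α : Type*} [Nonempty α] {l : Filter I} {P : I → α → Prop}
    (h : ∀ p : I → α, ∀ᶠ i in l, P i (p i)) : ∀ᶠ i in l, ∀ x, P i x := by
  classical
  have hp : ∀ i, ∃ x, (¬ ∀ y, P i y) → ¬ P i x := fun i => by
    by_cases hi : ∀ y, P i y
    · exact ⟨Classical.arbitrary α, fun h' => absurd hi h'⟩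
    · obtain ⟨x, hx⟩ := not_forall.1 hi
      exact ⟨x, fun _ => hx⟩
  choose p hp using hp
  filter_upwards [h p] with i hi
  by_contra hcon
  exact hp i hcon hi

/-- Overspill: if there is an infinite hypernatural number, then a sequence of internal properties
that hold at every standard index also holds at some infinite index. -/
theorem exists_tendsto_of_forall_eventually {I : Type*} {l : Filter I} {M : I → ℕ}
    (hM : Tendsto M l atTop) {P : ℕ → I → Prop} (h : ∀ n, ∀ᶠ i in l, P n i) :
    ∃ N : I → ℕ, Tendsto N l atTop ∧ ∀ᶠ i in l, P (N i) i := by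
  classical
  refine ⟨fun i => Nat.findGreatest (fun n => P n i) (M i), ?_, ?_⟩
  · refine tendsto_atTop.2 fun n => ?_
    filter_upwards [h n, tendsto_atTop.1 hM n] with i hi hn
    exact Nat.le_findGreatest hn hi
  · filter_upwards [h 0] with i hi
    exact Nat.findGreatest_spec (P := fun n => P n i) (Nat.zero_le _) hi

/-- For an internal sequence with uniformly limited values there is an infinite index at which its
value is, up to an infinitesimal, at least the infimum of the standard parts of its values at
standard indices. This is how truncation levels and cell sizes are chosen. -/
theorem exists_tendsto_forall_sub_le {I : Type*} {U : Ultrafilter I} {M : I → ℕ}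
    (hM : Tendsto M U atTop) {x : ℕ → I → ℝ} {C : ℝ} (hC : ∀ n, ∀ᶠ i in U, |x n i| ≤ C) :
    ∃ N : I → ℕ, Tendsto N U atTop ∧
      ∀ ε > 0, ∃ n : ℕ, ∀ᶠ i in U, x n i - x (N i) i ≤ ε := by
  have hst : ∀ n, ∃ s, Tendsto (x n) U (nhds s) := fun n => by
    obtain ⟨s, -, hs⟩ := (isCompact_Icc (a := -C) (b := C)).ultrafilter_le_nhds (U.map (x n))
      (le_principal_iff.2 ((hC n).mono fun i hi => abs_le.1 hi))
    exact ⟨s, hs⟩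
  choose s hs using hst
  have hsC : ∀ n, -C ≤ s n := fun n =>
    ge_of_tendsto (hs n) ((hC n).mono fun i hi => (abs_le.1 hi).1)
  have hbdd : BddBelow (Set.range s) := ⟨-C, by rintro _ ⟨n, rfl⟩; exact hsC n⟩
  have hlow : ∀ n : ℕ, ∀ᶠ i in U, (⨅ k, s k) - 1 / (n + 1) < x n i := fun n => by
    refine (hs n).eventually (lt_mem_nhds ?_)
    have h1 := ciInf_le hbdd n
    have h2 : (0 : ℝ) < 1 / (n + 1) := Nat.one_div_pos_of_nat
    linarith
  obtain ⟨N, hN, hlowN⟩ := exists_tendsto_of_forall_eventually hM hlow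
  refine ⟨N, hN, fun ε hε => ?_⟩
  obtain ⟨n, hn⟩ := exists_lt_of_ciInf_lt (show (⨅ k, s k) < (⨅ k, s k) + ε / 2 by linarith)
  obtain ⟨m, hm⟩ := exists_nat_one_div_lt (show 0 < ε / 2 by linarith)
  refine ⟨n, ?_⟩
  filter_upwards [hlowN, (hs n).eventually (gt_mem_nhds hn), tendsto_atTop.1 hN m]
    with i h1 h2 h3
  have h4 : 1 / ((N i : ℝ) + 1) ≤ 1 / (m + 1) := Nat.one_div_le_one_div h3
  linarith

section hyperreal

variable {I : Type*} {U : Ultrafilter I}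

theorem infinitesimal_coe {x : I → ℝ} :
    Infinitesimal (x : Ultrapower U ℝ) ↔ ∀ ε > 0, ∀ᶠ i in U, |x i| < ε := by
  refine forall₂_congr fun ε _ => ?_
  rw [Germ.abs_def]
  exact Germ.coe_lt

theorem infinitesimal_coe_of_le {x : I → ℝ} (h : ∀ ε > 0, ∀ᶠ i in U, |x i| ≤ ε) :
    Infinitesimal (x : Ultrapower U ℝ) :=
  infinitesimal_coe.2 fun ε hε => (h (ε / 2) (half_pos hε)).mono fun i hi => by linarith

theorem infClose_coe {x y : I → ℝ} :
    InfClose (x : Ultrapower U ℝ) y ↔ ∀ ε > 0, ∀ᶠ i in U, |x i - y i| < ε :=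
  infinitesimal_coe (x := x - y)

theorem limited_coe {x : I → ℝ} :
    Limited (x : Ultrapower U ℝ) ↔ ∃ C, ∀ᶠ i in U, |x i| ≤ C := by
  refine exists_congr fun C => ?_
  rw [Germ.abs_def]
  exact Germ.coe_le

theorem Infinitesimal.of_le_add {x y z : Ultrapower U ℝ} (hy : Infinitesimal y)
    (hz : Infinitesimal z) (h0 : 0 ≤ x) (h : x ≤ y + z) : Infinitesimal x := by
  induction x using Germ.inductionOn with | _ x => ?_
  induction y using Germ.inductionOn with | _ y => ?_
  induction z using Germ.inductionOn with | _ z => ?_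
  rw [infinitesimal_coe] at *
  intro ε hε
  filter_upwards [hy _ (half_pos hε), hz _ (half_pos hε), Germ.coe_le.1 h0, Germ.coe_le.1 h]
    with i h1 h2 h3 h4
  have h5 : 0 ≤ x i := h3
  have h6 : x i ≤ y i + z i := h4
  rw [abs_of_nonneg h5]
  linarith [le_abs_self (y i), le_abs_self (z i)]

theorem Limited.of_le_add {x y z : Ultrapower U ℝ} (hy : Limited y)
    (hz : Limited z) (h0 : 0 ≤ x) (h : x ≤ y + z) : Limited x := by
  induction x using Germ.inductionOn with | _ x => ?_
  induction y using Germ.inductionOn with | _ y => ?_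
  induction z using Germ.inductionOn with | _ z => ?_
  rw [limited_coe] at *
  obtain ⟨C, hC⟩ := hy
  obtain ⟨D, hD⟩ := hz
  refine ⟨C + D, ?_⟩
  filter_upwards [hC, hD, Germ.coe_le.1 h0, Germ.coe_le.1 h] with i h1 h2 h3 h4
  have h5 : 0 ≤ x i := h3
  have h6 : x i ≤ y i + z i := h4
  rw [abs_of_nonneg h5]
  linarith [le_abs_self (y i), le_abs_self (z i)]

theorem internalMem_coe {x : I → ℝ} {A : I → Set ℝ} :
    InternalMem (x : Ultrapower U ℝ) (A : Ultrapower U (Set ℝ)) ↔ ∀ᶠ i in U, x i ∈ A i :=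
  Iff.rfl

end hyperreal

namespace NearInterval

variable {I : Type*} {U : Ultrafilter I} {a b : ℝ} (T : NearInterval U a b)

/-- A family of natural numbers that represents `ν`. -/
def len (i : I) : ℕ := Quotient.out T.ν i

/-- A family of sequences that represents `t`. -/
def node (i : I) : ℕ → ℝ := Quotient.out T.t i

/-- The points of the subdivision of index `i`. -/
def pts (i : I) : Set ℝ := {x | ∃ j ≤ T.len i, x = T.node i j}

/-- The Riemann sum over the subdivision of index `i`. -/
def sum (i : I) (F : ℝ → ℝ) : ℝ := riemannSum (T.len i) (T.node i) F

theorem coe_len : (T.len : Ultrapower U ℕ) = T.ν := Quotient.out_eq' T.ν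

theorem coe_node : (T.node : Ultrapower U (ℕ → ℝ)) = T.t := Quotient.out_eq' T.t

theorem integral_coe (A : I → Set ℝ) (f : I → ℝ → ℝ) :
    T.integral (A : Ultrapower U (Set ℝ)) (f : Ultrapower U (ℝ → ℝ)) =
      ((fun i => T.sum i ((A i).indicator (f i)) : I → ℝ) : Ultrapower U ℝ) := by
  rw [integral, ← coe_len, ← coe_node]
  rfl

theorem measure_coe (A : I → Set ℝ) :
    T.measure (A : Ultrapower U (Set ℝ)) =
      ((fun i => T.sum i ((A i).indicator 1) : I → ℝ) : Ultrapower U ℝ) :=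
  T.integral_coe A fun _ _ => 1

theorem totalIntegral_coe (f : I → ℝ → ℝ) :
    T.totalIntegral (f : Ultrapower U (ℝ → ℝ)) =
      ((fun i => T.sum i (f i) : I → ℝ) : Ultrapower U ℝ) := by
  refine (T.integral_coe (fun _ => Set.univ) f).trans ?_
  simp only [Set.indicator_univ]

theorem app_coe (f : I → ℝ → ℝ) (x : I → ℝ) :
    app (f : Ultrapower U (ℝ → ℝ)) (x : Ultrapower U ℝ) =
      ((fun i => f i (x i) : I → ℝ) : Ultrapower U ℝ) := rfl

theorem coe_mem_points {x : I → ℝ} :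
    (x : Ultrapower U ℝ) ∈ T.points ↔ ∀ᶠ i in U, x i ∈ T.pts i := by
  constructor
  · rintro ⟨j, hj, hx⟩
    induction j using Germ.inductionOn with | _ j => ?_
    rw [← coe_len, Germ.coe_le] at hj
    rw [← coe_node] at hx
    filter_upwards [hj, Germ.coe_eq.1 hx] with i h1 h2
    exact ⟨j i, h1, h2⟩
  · intro h
    obtain ⟨j, hj⟩ := h.choice
    refine ⟨(j : Ultrapower U ℕ), ?_, ?_⟩
    · rw [← coe_len, Germ.coe_le]
      exact hj.mono fun i hi => hi.1
    · rw [← coe_node]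
      exact Germ.coe_eq.2 (hj.mono fun i hi => hi.2)

/-- The subdivision of index `i` is strictly increasing from `a` to `b`. -/
structure Regular (i : I) : Prop where
  zero : T.node i 0 = a
  last : T.node i (T.len i) = b
  lt : ∀ j < T.len i, T.node i j < T.node i (j + 1)

theorem eventually_regular : ∀ᶠ i in U, T.Regular i := by
  have h0 := T.t_zero
  have h1 := T.t_last
  rw [← coe_node] at h0
  rw [← coe_node, ← coe_len] at h1
  have h2 : ∀ᶠ i in U, ∀ j, j < T.len i → T.node i j < T.node i (j + 1) := by
    refine eventually_forall_of_choice fun j => ?_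
    refine Ultrafilter.eventually_imp.2 fun hj => ?_
    have := T.t_lt (j : Ultrapower U ℕ) (by rw [← coe_len, Germ.coe_lt]; exact hj)
    rw [← coe_node] at this
    exact Germ.coe_lt.1 this
  filter_upwards [Germ.coe_eq.1 h0, Germ.coe_eq.1 h1, h2] with i h3 h4 h5
  exact ⟨h3, h4, h5⟩

theorem eventually_step_le {ε : ℝ} (hε : 0 < ε) :
    ∀ᶠ i in U, ∀ j < T.len i, T.node i (j + 1) - T.node i j ≤ ε := by
  refine eventually_forall_of_choice fun j => ?_
  refine Ultrafilter.eventually_imp.2 fun hj => ?_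
  have := T.t_step (j : Ultrapower U ℕ) (by rw [← coe_len, Germ.coe_lt]; exact hj)
  rw [← coe_node] at this
  exact (infinitesimal_coe.1 this ε hε).mono fun i hi => (le_abs_self _).trans hi.le

namespace Regular

variable {T} {i : I} (h : T.Regular i)

include h

theorem le (j : ℕ) (hj : j < T.len i) : T.node i j ≤ T.node i (j + 1) := (h.lt j hj).le

theorem node_mono {j k : ℕ} (hjk : j ≤ k) (hk : k ≤ T.len i) : T.node i j ≤ T.node i k := by
  induction k, hjk using Nat.le_induction with
  | base => exact le_rfl
  | succ k _ ih => exact (ih (by omega)).trans (h.le k (by omega))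

theorem mem_Icc {x : ℝ} (hx : x ∈ T.pts i) : x ∈ Set.Icc a b := by
  obtain ⟨j, hj, rfl⟩ := hx
  exact ⟨h.zero.symm.trans_le (h.node_mono (Nat.zero_le j) hj),
    (h.node_mono hj le_rfl).trans h.last.le⟩

theorem node_mem_Ico {j : ℕ} (hj : j < T.len i) : T.node i j ∈ Set.Ico a b :=
  ⟨h.zero.symm.trans_le (h.node_mono (Nat.zero_le j) hj.le),
    (h.lt j hj).trans_le ((h.node_mono hj le_rfl).trans h.last.le)⟩

theorem sum_const (c : ℝ) : T.sum i (fun _ => c) = c * (b - a) := by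
  rw [sum, riemannSum_const, h.zero, h.last]

theorem sum_mono {F G : ℝ → ℝ} (hFG : ∀ x ∈ T.pts i, F x ≤ G x) : T.sum i F ≤ T.sum i G :=
  riemannSum_mono h.le fun j hj => hFG _ ⟨j, hj.le, rfl⟩

theorem sum_nonneg {F : ℝ → ℝ} (hF : ∀ x, 0 ≤ F x) : 0 ≤ T.sum i F :=
  riemannSum_nonneg h.le fun _ _ => hF _

theorem sum_indicator_one_nonneg {A : Set ℝ} : 0 ≤ T.sum i (A.indicator 1) :=
  h.sum_nonneg fun x => Set.indicator_nonneg (fun _ _ => zero_le_one) x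

theorem abs_sum_le {F G : ℝ → ℝ} (hFG : ∀ x ∈ T.pts i, |F x| ≤ G x) : |T.sum i F| ≤ T.sum i G :=
  abs_riemannSum_le h.le fun j hj => hFG _ ⟨j, hj.le, rfl⟩

theorem sum_indicator_mono {A B : Set ℝ} {F : ℝ → ℝ} (hF : ∀ x, 0 ≤ F x)
    (hAB : ∀ x ∈ T.pts i, x ∈ A → x ∈ B) :
    T.sum i (A.indicator F) ≤ T.sum i (B.indicator F) := by
  refine h.sum_mono fun x hx => ?_
  by_cases hA : x ∈ A
  · rw [Set.indicator_of_mem hA, Set.indicator_of_mem (hAB x hx hA)]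
  · rw [Set.indicator_of_notMem hA]
    exact Set.indicator_nonneg (fun y _ => hF y) x

end Regular

theorem sum_add (i : I) (F G : ℝ → ℝ) : T.sum i (fun x => F x + G x) = T.sum i F + T.sum i G :=
  riemannSum_add _ _ F G

theorem sum_sub (i : I) (F G : ℝ → ℝ) : T.sum i (fun x => F x - G x) = T.sum i F - T.sum i G :=
  riemannSum_sub _ _ F G

theorem sum_const_mul (i : I) (c : ℝ) (F : ℝ → ℝ) : T.sum i (fun x => c * F x) = c * T.sum i F :=
  riemannSum_const_mul _ _ c F

theorem sum_congr {i : I} {F G : ℝ → ℝ} (h : ∀ x ∈ T.pts i, F x = G x) : T.sum i F = T.sum i G :=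
  riemannSum_congr fun j hj => h _ ⟨j, hj.le, rfl⟩

/-- Either the near interval is reduced to a point, or its first step yields an infinite
hypernatural number, so that overspill is available. -/
theorem eventually_len_eq_zero_or :
    (∀ᶠ i in U, T.len i = 0) ∨ ∃ M : I → ℕ, Tendsto M U atTop := by
  refine or_iff_not_imp_left.2 fun h0 => ?_
  rw [← Ultrafilter.eventually_not] at h0
  refine ⟨fun i => ⌊1 / (T.node i 1 - T.node i 0)⌋₊, tendsto_atTop.2 fun n => ?_⟩
  have hp : (0 : ℝ) < 1 / (n + 1) := Nat.one_div_pos_of_nat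
  filter_upwards [h0, T.eventually_regular, T.eventually_step_le hp] with i h1 h2 h3
  have hl : 0 < T.len i := Nat.pos_of_ne_zero h1
  have h4 := h2.lt 0 hl
  have h5 := h3 0 hl
  rw [zero_add] at h4 h5
  refine Nat.le_floor ?_
  rw [le_div_iff₀ (sub_pos.2 h4)]
  rw [le_div_iff₀ (by positivity)] at h5
  nlinarith

/-! ### Integrability in terms of representatives -/

theorem integral_absFun_nonneg (A : Ultrapower U (Set ℝ)) (f : Ultrapower U (ℝ → ℝ)) :
    0 ≤ T.integral A (absFun f) := by
  induction A using Germ.inductionOn with | _ A => ?_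
  induction f using Germ.inductionOn with | _ f => ?_
  rw [show absFun (f : Ultrapower U (ℝ → ℝ)) = ((fun i x => |f i x| : I → ℝ → ℝ) :) from rfl,
    integral_coe]
  refine Germ.coe_le.2 ?_
  filter_upwards [T.eventually_regular] with i hi
  exact hi.sum_nonneg fun x => Set.indicator_nonneg (fun _ _ => abs_nonneg _) x

theorem integral_absFun_le {f g k : I → ℝ → ℝ}
    (h : ∀ᶠ i in U, ∀ x ∈ T.pts i, |k i x| ≤ |f i x| + |g i x|) (A : Ultrapower U (Set ℝ)) :
    T.integral A (absFun (k : Ultrapower U (ℝ → ℝ))) ≤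
      T.integral A (absFun (f : Ultrapower U (ℝ → ℝ))) +
        T.integral A (absFun (g : Ultrapower U (ℝ → ℝ))) := by
  induction A using Germ.inductionOn with | _ A => ?_
  have e : ∀ f : I → ℝ → ℝ, absFun (f : Ultrapower U (ℝ → ℝ)) =
    ((fun i x => |f i x| : I → ℝ → ℝ) : Ultrapower U (ℝ → ℝ)) := fun _ => rfl
  rw [e, e, e, integral_coe, integral_coe, integral_coe]
  refine Germ.coe_le.2 ?_
  filter_upwards [h, T.eventually_regular] with i hi hr
  refine (hr.sum_mono (G := fun x => (A i).indicator (fun x => |f i x|) x +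
    (A i).indicator (fun x => |g i x|) x) fun x hx => ?_).trans_eq (T.sum_add _ _ _)
  by_cases hA : x ∈ A i
  · simpa [hA] using hi x hx
  · simp [hA]

variable {T} in
theorem SIntegrable.of_le {f g k : I → ℝ → ℝ} (hf : T.SIntegrable (f : Ultrapower U (ℝ → ℝ)))
    (hg : T.SIntegrable (g : Ultrapower U (ℝ → ℝ)))
    (h : ∀ᶠ i in U, ∀ x ∈ T.pts i, |k i x| ≤ |f i x| + |g i x|) :
    T.SIntegrable (k : Ultrapower U (ℝ → ℝ)) := fun c d hac hcd hdb =>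
  ⟨(hf c d hac hcd hdb).1.of_le_add (hg c d hac hcd hdb).1 (T.integral_absFun_nonneg _ _)
      (T.integral_absFun_le h _),
    fun hi => ((hf c d hac hcd hdb).2 hi).of_le_add ((hg c d hac hcd hdb).2 hi)
      (T.integral_absFun_nonneg _ _) (T.integral_absFun_le h _)⟩

variable {T} in
theorem AbsolutelySIntegrable.of_le {f g k : I → ℝ → ℝ}
    (hf : T.AbsolutelySIntegrable (f : Ultrapower U (ℝ → ℝ)))
    (hg : T.AbsolutelySIntegrable (g : Ultrapower U (ℝ → ℝ)))
    (h : ∀ᶠ i in U, ∀ x ∈ T.pts i, |k i x| ≤ |f i x| + |g i x|) :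
    T.AbsolutelySIntegrable (k : Ultrapower U (ℝ → ℝ)) :=
  ⟨hf.1.of_le_add hg.1 (T.integral_absFun_nonneg _ _) (T.integral_absFun_le h _),
    fun A hA => (hf.2 A hA).of_le_add (hg.2 A hA)
      (T.integral_absFun_nonneg _ _) (T.integral_absFun_le h _)⟩

theorem eventually_sum_abs_le_of_limited {f : I → ℝ → ℝ}
    (h : Limited (T.totalIntegral (absFun (f : Ultrapower U (ℝ → ℝ))))) :
    ∃ C, ∀ᶠ i in U, T.sum i (fun x => |f i x|) ≤ C := by
  have h1 := h
  rw [show absFun (f : Ultrapower U (ℝ → ℝ)) = ((fun i x => |f i x| : I → ℝ → ℝ) :) from rfl,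
    totalIntegral_coe, limited_coe] at h1
  obtain ⟨C, hC⟩ := h1
  exact ⟨C, hC.mono fun i hi => (le_abs_self _).trans hi⟩

variable {T} in
theorem SIntegrable.eventually_sum_abs_le {f : I → ℝ → ℝ}
    (h : T.SIntegrable (f : Ultrapower U (ℝ → ℝ))) :
    ∃ C, ∀ᶠ i in U, T.sum i (fun x => |f i x|) ≤ C := by
  have hab : a ≤ b := by
    obtain ⟨i, hi⟩ := T.eventually_regular.exists
    have := hi.node_mono (Nat.zero_le _) le_rfl
    rwa [hi.zero, hi.last] at this
  have h1 := (h a b le_rfl (Germ.const_le hab) le_rfl).1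
  rw [show absFun (f : Ultrapower U (ℝ → ℝ)) = ((fun i x => |f i x| : I → ℝ → ℝ) :) from rfl,
    show Germ.map₂ Set.Ico (a : Ultrapower U ℝ) (b : Ultrapower U ℝ) =
      ((fun _ => Set.Ico a b : I → Set ℝ) : Ultrapower U (Set ℝ)) from rfl,
    integral_coe, limited_coe] at h1
  obtain ⟨C, hC⟩ := h1
  refine ⟨C, ?_⟩
  filter_upwards [hC, T.eventually_regular] with i hi hr
  refine le_trans (le_of_eq ?_) ((le_abs_self _).trans hi)
  exact riemannSum_congr fun j hj => by rw [Set.indicator_of_mem (hr.node_mem_Ico hj)]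

variable {T} in
/-- By overspill, absolute `S`-integrability is absolute continuity in the `ε`-`δ` sense. -/
theorem AbsolutelySIntegrable.exists_delta {M : I → ℕ} (hM : Tendsto M U atTop) {f : I → ℝ → ℝ}
    (h : T.AbsolutelySIntegrable (f : Ultrapower U (ℝ → ℝ))) {ε : ℝ} (hε : 0 < ε) :
    ∃ δ > 0, ∀ᶠ i in U, ∀ A : Set ℝ, T.sum i (A.indicator 1) ≤ δ →
      T.sum i (A.indicator fun x => |f i x|) ≤ ε := by
  by_contra! hcon
  have hbad : ∀ n : ℕ, ∀ᶠ i in U, ∃ A : Set ℝ, T.sum i (A.indicator 1) ≤ 1 / ((n : ℝ) + 1) ∧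
      ε < T.sum i (A.indicator fun x => |f i x|) := fun n =>
    hcon (1 / ((n : ℝ) + 1)) Nat.one_div_pos_of_nat
  obtain ⟨N, hN, hbadN⟩ := exists_tendsto_of_forall_eventually hM hbad
  obtain ⟨A, hA⟩ := hbadN.choice
  have hmA : Infinitesimal (T.measure (A : Ultrapower U (Set ℝ))) := by
    rw [measure_coe]
    refine infinitesimal_coe_of_le fun η hη => ?_
    obtain ⟨m, hm⟩ := exists_nat_one_div_lt hη
    filter_upwards [hA, T.eventually_regular, tendsto_atTop.1 hN m] with i h1 h2 h3
    rw [abs_of_nonneg h2.sum_indicator_one_nonneg]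
    have h4 : 1 / ((N i : ℝ) + 1) ≤ 1 / (m + 1) := Nat.one_div_le_one_div h3
    linarith [h1.1]
  have hint := h.2 _ hmA
  rw [show absFun (f : Ultrapower U (ℝ → ℝ)) = ((fun i x => |f i x| : I → ℝ → ℝ) :) from rfl,
    integral_coe, infinitesimal_coe] at hint
  obtain ⟨i, h1, h2⟩ := ((hint ε hε).and hA).exists
  linarith [le_abs_self (T.sum i ((A i).indicator fun x => |f i x|)), h2.2]

/-- Uniform integrability: on a standard scale, the part of the integral of `|f|` that comes from
the large values of `f` is small. -/
def SmallTails (f : I → ℝ → ℝ) : Prop :=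
  ∀ ε > 0, ∃ M : ℝ, 0 < M ∧ ∀ᶠ i in U,
    T.sum i ({x | M < |f i x|}.indicator fun x => |f i x|) ≤ ε

theorem Regular.mul_sum_indicator_lt_le {T : NearInterval U a b} {i : I} (h : T.Regular i)
    (f : ℝ → ℝ) (r : ℝ) :
    r * T.sum i ({x | r < |f x|}.indicator 1) ≤ T.sum i fun x => |f x| := by
  rw [← sum_const_mul]
  refine h.sum_mono fun x _ => ?_
  by_cases hx : r < |f x|
  · rw [Set.indicator_of_mem (by exact hx), Pi.one_apply]
    linarith
  · rw [Set.indicator_of_notMem (by exact hx), mul_zero]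
    exact abs_nonneg _

variable {T} in
theorem AbsolutelySIntegrable.smallTails {M : I → ℕ} (hM : Tendsto M U atTop) {f : I → ℝ → ℝ}
    (h : T.AbsolutelySIntegrable (f : Ultrapower U (ℝ → ℝ))) : T.SmallTails f := by
  intro ε hε
  obtain ⟨δ, hδ, hA⟩ := h.exists_delta hM hε
  obtain ⟨C, hC⟩ := T.eventually_sum_abs_le_of_limited h.1
  have hr : 0 < (|C| + 1) / δ := by positivity
  refine ⟨(|C| + 1) / δ, hr, ?_⟩
  filter_upwards [hA, hC, T.eventually_regular] with i h1 h2 h3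
  refine h1 _ ?_
  have h4 := h3.mul_sum_indicator_lt_le (f i) ((|C| + 1) / δ)
  rw [div_mul_eq_mul_div, div_le_iff₀ hδ] at h4
  have h5 : (|C| + 1) * T.sum i ({x | (|C| + 1) / δ < |f i x|}.indicator 1) ≤ (|C| + 1) * δ := by
    nlinarith [le_abs_self C]
  exact le_of_mul_le_mul_left h5 (by positivity)

variable {T} in
/-- The criterion covers both `k = f` and averages `k` of `f`: on each set, `|k|` is dominated by
a constant `M` up to the part of the integral of `|f|` that comes from values above `M`. -/
theorem SmallTails.absolutelySIntegrable {f k : I → ℝ → ℝ} (hf : T.SmallTails f) {C : ℝ}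
    (hC : ∀ᶠ i in U, T.sum i (fun x => |k i x|) ≤ C)
    (hk : ∀ M : ℝ, 0 < M → ∀ᶠ i in U, ∀ A : Set ℝ, T.sum i (A.indicator fun x => |k i x|) ≤
      M * T.sum i (A.indicator 1) + T.sum i ({x | M < |f i x|}.indicator fun x => |f i x|)) :
    T.AbsolutelySIntegrable (k : Ultrapower U (ℝ → ℝ)) := by
  rw [AbsolutelySIntegrable,
    show absFun (k : Ultrapower U (ℝ → ℝ)) = ((fun i x => |k i x| : I → ℝ → ℝ) :) from rfl]
  constructor
  · rw [totalIntegral_coe, limited_coe]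
    refine ⟨C, ?_⟩
    filter_upwards [hC, T.eventually_regular] with i h1 h2
    rwa [abs_of_nonneg (h2.sum_nonneg fun _ => abs_nonneg _)]
  · intro A hA
    induction A using Germ.inductionOn with | _ A => ?_
    rw [measure_coe, infinitesimal_coe] at hA
    rw [integral_coe]
    refine infinitesimal_coe_of_le fun ε hε => ?_
    obtain ⟨M, hM, htail⟩ := hf (ε / 2) (half_pos hε)
    filter_upwards [hk M hM, htail, hA (ε / 2 / M) (by positivity), T.eventually_regular]
      with i h1 h2 h3 h4
    rw [abs_of_nonneg (h4.sum_nonneg fun x => Set.indicator_nonneg (fun _ _ => abs_nonneg _) x)]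
    have h5 := (le_abs_self _).trans h3.le
    rw [le_div_iff₀ hM] at h5
    linarith [h1 (A i)]

variable {T} in
/-- An interval of infinitesimal length has infinitesimal measure. -/
theorem AbsolutelySIntegrable.sIntegrable {f : I → ℝ → ℝ}
    (h : T.AbsolutelySIntegrable (f : Ultrapower U (ℝ → ℝ))) :
    T.SIntegrable (f : Ultrapower U (ℝ → ℝ)) := by
  intro c d _ hcd _
  refine ⟨?_, fun hdc => h.2 _ ?_⟩
  · obtain ⟨C, hC⟩ := T.eventually_sum_abs_le_of_limited h.1
    induction c using Germ.inductionOn with | _ c => ?_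
    induction d using Germ.inductionOn with | _ d => ?_
    rw [show absFun (f : Ultrapower U (ℝ → ℝ)) = ((fun i x => |f i x| : I → ℝ → ℝ) :) from rfl,
      show Germ.map₂ Set.Ico (c : Ultrapower U ℝ) (d : Ultrapower U ℝ) =
        ((fun i => Set.Ico (c i) (d i) : I → Set ℝ) : Ultrapower U (Set ℝ)) from rfl,
      integral_coe, limited_coe]
    refine ⟨C, ?_⟩
    filter_upwards [hC, T.eventually_regular] with i h1 h2
    rw [abs_of_nonneg (h2.sum_nonneg fun x => Set.indicator_nonneg (fun _ _ => abs_nonneg _) x)]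
    exact (h2.sum_mono fun x _ => Set.indicator_le_self' (fun _ _ => abs_nonneg _) x).trans h1
  · induction c using Germ.inductionOn with | _ c => ?_
    induction d using Germ.inductionOn with | _ d => ?_
    rw [show Germ.map₂ Set.Ico (c : Ultrapower U ℝ) (d : Ultrapower U ℝ) =
        ((fun i => Set.Ico (c i) (d i) : I → Set ℝ) : Ultrapower U (Set ℝ)) from rfl, measure_coe]
    have hdc' : ∀ ε > 0, ∀ᶠ i in U, |d i - c i| < ε := infClose_coe.1 hdc
    refine infinitesimal_coe_of_le fun ε hε => ?_
    filter_upwards [hdc' _ (half_pos hε), T.eventually_step_le (half_pos hε),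
      T.eventually_regular, Germ.coe_le.1 hcd] with i h1 h2 h3 h4
    rw [abs_of_nonneg h3.sum_indicator_one_nonneg]
    have h5 := riemannSum_indicator_Icc_le h3.le h2 (half_pos hε).le h4
    have h6 := h3.sum_indicator_mono (F := 1) (fun _ => zero_le_one)
      (fun x _ (hx : x ∈ Set.Ico (c i) (d i)) => Set.Ico_subset_Icc_self hx)
    have h7 : T.sum i ((Set.Icc (c i) (d i)).indicator 1) ≤ d i - c i + ε / 2 := h5
    linarith [le_abs_self (d i - c i)]

theorem rare_iff {R : Set (Ultrapower U ℝ)} :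
    T.Rare R ↔ ∀ α > 0, ∃ B : I → Set ℝ, (∀ x ∈ R, InternalMem x (B : Ultrapower U (Set ℝ))) ∧
      ∀ᶠ i in U, T.sum i ((B i).indicator 1) ≤ α := by
  refine forall₂_congr fun α _ => ⟨?_, ?_⟩
  · rintro ⟨B, hB, hm⟩
    induction B using Germ.inductionOn with | _ B => ?_
    rw [measure_coe] at hm
    exact ⟨B, hB, Germ.coe_le.1 hm⟩
  · rintro ⟨B, hB, hm⟩
    refine ⟨B, hB, ?_⟩
    rw [measure_coe]
    exact Germ.coe_le.2 hm

/-! ### Almost continuity and quadrability in terms of representatives -/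

/-- The `ε`-`δ` form of almost continuity: outside internal sets of arbitrarily small standard
measure, `f` satisfies the condition of uniform continuity for a given standard `ε`. -/
def AlmostUniform (f : I → ℝ → ℝ) : Prop :=
  ∀ ε > 0, ∀ α > 0, ∃ B : I → Set ℝ, (∀ᶠ i in U, T.sum i ((B i).indicator 1) ≤ α) ∧
    ∃ δ > 0, ∀ᶠ i in U, ∀ x ∈ T.pts i, ∀ y ∈ T.pts i, x ∉ B i → y ∉ B i → |x - y| ≤ δ →
      |f i x - f i y| ≤ ε

variable {T} in
theorem AlmostUniform.add {f g : I → ℝ → ℝ} (hf : T.AlmostUniform f) (hg : T.AlmostUniform g) :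
    T.AlmostUniform fun i x => f i x + g i x := by
  intro ε hε α hα
  obtain ⟨B, hB, δ, hδ, hfB⟩ := hf (ε / 2) (half_pos hε) (α / 2) (half_pos hα)
  obtain ⟨D, hD, η, hη, hgD⟩ := hg (ε / 2) (half_pos hε) (α / 2) (half_pos hα)
  refine ⟨fun i => B i ∪ D i, ?_, min δ η, lt_min hδ hη, ?_⟩
  · filter_upwards [hB, hD, T.eventually_regular] with i h1 h2 h3
    have h4 : T.sum i ((B i ∪ D i).indicator 1) ≤
        T.sum i ((B i).indicator 1) + T.sum i ((D i).indicator 1) := by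
      rw [← sum_add]
      refine h3.sum_mono fun x _ => ?_
      by_cases hxB : x ∈ B i <;> by_cases hxD : x ∈ D i <;> simp [hxB, hxD]
    linarith
  · filter_upwards [hfB, hgD] with i h1 h2 x hx y hy hxB hyB hxy
    have h3 := h1 x hx y hy (fun h => hxB (Or.inl h)) (fun h => hyB (Or.inl h))
      (hxy.trans (min_le_left _ _))
    have h4 := h2 x hx y hy (fun h => hxB (Or.inr h)) (fun h => hyB (Or.inr h))
      (hxy.trans (min_le_right _ _))
    rw [add_sub_add_comm]
    linarith [abs_add_le (f i x - f i y) (g i x - g i y)]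

variable {T} in
/-- The exceptional sets `B k` for `ε = 1 / (k + 1)` have measure at most `2⁻ᵏ`; the points in
infinitely many of them form a rare set, because `⋃ k ≥ j, B k` is covered, by overspill, by an
internal set of measure at most `2 * 2⁻ʲ`. -/
theorem AlmostUniform.almostContinuous {M : I → ℕ} (hM : Tendsto M U atTop) {f : I → ℝ → ℝ}
    (hf : T.AlmostUniform f) : T.AlmostContinuous (f : Ultrapower U (ℝ → ℝ)) := by
  choose B hB δ hδ hfB using fun k : ℕ =>
    hf (1 / ((k : ℝ) + 1)) Nat.one_div_pos_of_nat ((1 / 2) ^ k) (by positivity)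
  refine ⟨{x | x ∈ T.points ∧ ∀ j : ℕ, ∃ k ≥ j, InternalMem x (B k : Ultrapower U (Set ℝ))},
    fun x hx => hx.1, ?_, ?_⟩
  · rw [rare_iff]
    intro α hα
    obtain ⟨j, hj⟩ := exists_pow_lt_of_lt_one (half_pos hα) (one_half_lt_one (α := ℝ))
    let D : ℕ → I → Set ℝ := fun n i => {x | ∃ k ∈ Finset.Ico j n, x ∈ B k i}
    have hD : ∀ n, ∀ᶠ i in U, T.sum i ((D n i).indicator 1) ≤ α := by
      intro n
      filter_upwards [(Finset.eventually_all (Finset.Ico j n)).2 fun k _ => hB k,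
        T.eventually_regular] with i h1 h2
      have h3 : T.sum i ((D n i).indicator 1) ≤
          T.sum i fun x => ∑ k ∈ Finset.Ico j n, (B k i).indicator 1 x := by
        refine h2.sum_mono fun x _ => ?_
        have hnn : ∀ k ∈ Finset.Ico j n, 0 ≤ (B k i).indicator (1 : ℝ → ℝ) x := fun k _ =>
          Set.indicator_nonneg (fun _ _ => zero_le_one) _
        by_cases hx : x ∈ D n i
        · obtain ⟨k, hk, hxk⟩ := hx
          rw [Set.indicator_of_mem (show x ∈ D n i from ⟨k, hk, hxk⟩)]
          simpa [hxk] using Finset.single_le_sum hnn hk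
        · rw [Set.indicator_of_notMem hx]
          exact Finset.sum_nonneg hnn
      have h4 : T.sum i (fun x => ∑ k ∈ Finset.Ico j n, (B k i).indicator 1 x) =
          ∑ k ∈ Finset.Ico j n, T.sum i ((B k i).indicator 1) := riemannSum_sum _ _ _ _
      have h5 := Finset.sum_le_sum h1
      have h6 := geom_sum_Ico_le_of_lt_one (m := j) (n := n) (x := (1 / 2 : ℝ))
        (by norm_num) (by norm_num)
      have h7 : (1 / 2 : ℝ) ^ j / (1 - 1 / 2) = 2 * (1 / 2) ^ j := by ring
      linarith
    obtain ⟨N, hN, hDN⟩ := exists_tendsto_of_forall_eventually hM hD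
    refine ⟨fun i => D (N i) i, ?_, hDN⟩
    rintro x ⟨-, hx⟩
    obtain ⟨k, hk, hxk⟩ := hx j
    induction x using Germ.inductionOn with | _ x => ?_
    rw [internalMem_coe] at hxk ⊢
    filter_upwards [hxk, tendsto_atTop.1 hN (k + 1)] with i h1 h2
    exact ⟨k, Finset.mem_Ico.2 ⟨hk, h2⟩, h1⟩
  · rintro x ⟨hx, hxR⟩ y ⟨hy, hyR⟩ hxy
    obtain ⟨j, hj⟩ : ∃ j : ℕ, ∀ k ≥ j, ¬ InternalMem x (B k : Ultrapower U (Set ℝ)) := by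
      by_contra! h
      exact hxR ⟨hx, h⟩
    obtain ⟨l, hl⟩ : ∃ j : ℕ, ∀ k ≥ j, ¬ InternalMem y (B k : Ultrapower U (Set ℝ)) := by
      by_contra! h
      exact hyR ⟨hy, h⟩
    induction x using Germ.inductionOn with | _ x => ?_
    induction y using Germ.inductionOn with | _ y => ?_
    rw [coe_mem_points] at hx hy
    rw [infClose_coe] at hxy
    refine infinitesimal_coe_of_le (x := fun i => f i (x i) - f i (y i)) fun ε hε => ?_
    obtain ⟨m, hm⟩ := exists_nat_one_div_lt hε
    set k := max m (max j l)
    have hxk := Ultrafilter.eventually_not.2 (hj k (by omega))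
    have hyk := Ultrafilter.eventually_not.2 (hl k (by omega))
    filter_upwards [hx, hy, hxk, hyk, hfB k, hxy _ (hδ k)] with i h1 h2 h3 h4 h5 h6
    have h7 := h5 _ h1 _ h2 h3 h4 h6.le
    have h8 : 1 / ((k : ℝ) + 1) ≤ 1 / (m + 1) := Nat.one_div_le_one_div (le_max_left _ _)
    linarith

variable {T} in
theorem AlmostContinuous.almostUniform {M : I → ℕ} (hM : Tendsto M U atTop) {f : I → ℝ → ℝ}
    (hf : T.AlmostContinuous (f : Ultrapower U (ℝ → ℝ))) : T.AlmostUniform f := by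
  obtain ⟨R, -, hR, hfR⟩ := hf
  rw [rare_iff] at hR
  intro ε hε α hα
  obtain ⟨B, hRB, hB⟩ := hR α hα
  refine ⟨B, hB, ?_⟩
  by_contra! hcon
  obtain ⟨N, hN, hbad⟩ := exists_tendsto_of_forall_eventually hM fun n =>
    hcon (1 / ((n : ℝ) + 1)) Nat.one_div_pos_of_nat
  obtain ⟨x, hx⟩ := hbad.choice
  obtain ⟨y, hy⟩ := (hx.mono fun i hi => hi.2).choice
  have hxR : (x : Ultrapower U ℝ) ∉ R := fun h => by
    obtain ⟨i, h1, h2⟩ := ((hRB _ h).and hy).exists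
    exact h2.2.1 h1
  have hyR : (y : Ultrapower U ℝ) ∉ R := fun h => by
    obtain ⟨i, h1, h2⟩ := ((hRB _ h).and hy).exists
    exact h2.2.2.1 h1
  have hxy : InfClose (x : Ultrapower U ℝ) y := by
    refine infinitesimal_coe_of_le (x := fun i => x i - y i) fun η hη => ?_
    obtain ⟨m, hm⟩ := exists_nat_one_div_lt hη
    filter_upwards [hy, tendsto_atTop.1 hN m] with i h1 h2
    have h3 : 1 / ((N i : ℝ) + 1) ≤ 1 / (m + 1) := Nat.one_div_le_one_div h2
    linarith [h1.2.2.2.1]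
  have := hfR _ ⟨T.coe_mem_points.2 (hx.mono fun i hi => hi.1), hxR⟩ _
    ⟨T.coe_mem_points.2 (hy.mono fun i hi => hi.1), hyR⟩ hxy
  rw [app_coe, app_coe, infClose_coe] at this
  obtain ⟨i, h1, h2⟩ := ((this ε hε).and hy).exists
  linarith [h2.2.2.2.2]

theorem exists_nearDyadic_le (k : ℕ) {α : ℝ} (hα : 0 < α) :
    ∃ δ > 0, ∀ᶠ i in U, T.sum i ((nearDyadic k δ).indicator 1) ≤ α := by
  set c : ℝ := ((Finset.Icc (⌊(2 : ℝ) ^ k * a⌋ - 1) (⌈(2 : ℝ) ^ k * b⌉ + 1)).card : ℝ) with hc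
  have hc0 : 0 ≤ c := Nat.cast_nonneg _
  set δ := min 1 (α / (3 * (c + 1)))
  have hδ : 0 < δ := lt_min one_pos (by positivity)
  refine ⟨δ, hδ, ?_⟩
  filter_upwards [T.eventually_regular, T.eventually_step_le hδ] with i h1 h2
  refine (riemannSum_indicator_nearDyadic_le k h1.le (fun j hj => h1.mem_Icc ⟨j, hj.le, rfl⟩) h2
    hδ.le hδ.le (min_le_left _ _)).trans ?_
  rw [← hc]
  have h3 : δ ≤ α / (3 * (c + 1)) := min_le_right _ _
  rw [le_div_iff₀ (by positivity)] at h3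
  nlinarith

/-- Unions of cells of a standard level are quadrable: their boundary is contained in the halo of
the dyadic numbers of that level. -/
theorem quadrable_preimage_cell (k : ℕ) (S : I → Set ℤ) :
    T.Quadrable ((fun i => cell k ⁻¹' S i : I → Set ℝ) : Ultrapower U (Set ℝ)) := by
  rw [Quadrable, rare_iff]
  intro α hα
  obtain ⟨δ, hδ, hm⟩ := T.exists_nearDyadic_le k hα
  refine ⟨fun _ => nearDyadic k δ, ?_, hm⟩
  rintro x ⟨-, ⟨y, -, hxy, hyA⟩, z, -, hxz, hzA⟩
  induction x using Germ.inductionOn with | _ x => ?_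
  induction y using Germ.inductionOn with | _ y => ?_
  induction z using Germ.inductionOn with | _ z => ?_
  rw [infClose_coe] at hxy hxz
  rw [internalMem_coe] at hyA ⊢
  replace hzA := Ultrafilter.eventually_not.2 hzA
  have hp : (0 : ℝ) < 2 ^ k := by positivity
  filter_upwards [hyA, hzA, hxy _ (div_pos hδ hp), hxz _ (div_pos hδ hp)] with i h1 h2 h3 h4
  rw [lt_div_iff₀' hp] at h3 h4
  by_cases h : cell k (x i) = cell k (y i)
  · obtain ⟨c, hc⟩ := exists_int_of_cell_ne (k := k) (x := x i) (y := z i)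
      (fun h' => h2 (by
        rw [Set.mem_preimage] at h1 ⊢
        rwa [← h', h]))
    exact ⟨c, hc.trans h4.le⟩
  · obtain ⟨c, hc⟩ := exists_int_of_cell_ne h
    exact ⟨c, hc.trans h3.le⟩

/-! ### The trend: averages over infinitesimal cells -/

/-- The average of `f` over the cell of level `k`, for the subdivision of index `i`. -/
def avg (i : I) (k : ℕ) (f : ℝ → ℝ) : ℝ → ℝ := condAvg (T.len i) (T.node i) k f

/-- Convergence in measure of the martingale of averages, by stabilization of the energy. -/
theorem exists_almostUniform_avg {M : I → ℕ} (hM : Tendsto M U atTop) {f : I → ℝ → ℝ} {C : ℝ}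
    (hC : ∀ᶠ i in U, T.sum i (fun x => |f i x|) ≤ C) :
    ∃ N : I → ℕ, Tendsto N U atTop ∧ T.AlmostUniform fun i => T.avg i (N i) (f i) := by
  obtain ⟨N, hN, hstab⟩ := exists_tendsto_forall_sub_le (U := U) hM (C := b - a + C)
    (x := fun n i => -energy (T.len i) (T.node i) (f i) n) fun n => by
      filter_upwards [hC, T.eventually_regular] with i h1 h2
      have h3 := energy_le h2.le (f i) n
      rw [h2.zero, h2.last] at h3
      rw [abs_neg, abs_of_nonneg (energy_nonneg h2.le _ _)]
      exact h3.trans (add_le_add_right h1 _)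
  refine ⟨N, hN, fun ε hε α hα => ?_⟩
  -- values above `r` contribute at most `α / 4`, and `D` is the factor in front of the energies
  set r : ℝ := 8 * (|C| + 1) / α with hr
  have hr0 : 0 < r := by positivity
  set D : ℝ := 2 * (1 + r ^ 2) ^ 2 / (ε / 2) ^ 2 with hD
  have hD0 : 0 < D := by positivity
  obtain ⟨n, hn⟩ := hstab (α / 4 / D) (by positivity)
  obtain ⟨δ, hδ, hδm⟩ := T.exists_nearDyadic_le n (half_pos hα)
  refine ⟨fun i => {x | ε / 2 < |T.avg i (N i) (f i) x - T.avg i n (f i) x|} ∪ nearDyadic n δ,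
    ?_, δ / 2 ^ n, by positivity, ?_⟩
  · filter_upwards [hn, hδm, hC, T.eventually_regular, tendsto_atTop.1 hN n] with i h1 h2 h3 h4 h5
    have h6 : T.sum i (({x | ε / 2 < |T.avg i (N i) (f i) x - T.avg i n (f i) x|} ∪
        nearDyadic n δ).indicator 1) ≤
        T.sum i ({x | ε / 2 < |T.avg i (N i) (f i) x - T.avg i n (f i) x|}.indicator 1) +
          T.sum i ((nearDyadic n δ).indicator 1) := by
      rw [← sum_add]
      refine h4.sum_mono fun x _ => ?_
      by_cases hxB : x ∈ {x | ε / 2 < |T.avg i (N i) (f i) x - T.avg i n (f i) x|} <;>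
        by_cases hxD : x ∈ nearDyadic n δ <;>
        simp only [Set.mem_union, hxB, hxD, Set.indicator_of_mem, Set.indicator_of_notMem, or_self,
          or_true, true_or, not_false_iff, Pi.one_apply] <;> norm_num
    have h7 : T.sum i ({x | ε / 2 < |T.avg i (N i) (f i) x - T.avg i n (f i) x|}.indicator 1) ≤
        2 * T.sum i (fun x => |f i x|) / r + D * (energy (T.len i) (T.node i) (f i) (N i) -
          energy (T.len i) (T.node i) (f i) n) :=
      riemannSum_indicator_lt_le h4.le h5 (f i) (half_pos hε) hr0
    have h8 : 2 * T.sum i (fun x => |f i x|) / r ≤ α / 4 := by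
      rw [div_le_iff₀ hr0, hr]
      have : α / 4 * (8 * (|C| + 1) / α) = 2 * (|C| + 1) := by field_simp; norm_num
      rw [this]
      linarith [le_abs_self C]
    have h9 : D * (energy (T.len i) (T.node i) (f i) (N i) -
        energy (T.len i) (T.node i) (f i) n) ≤ α / 4 := by
      rw [le_div_iff₀ hD0] at h1
      linarith
    linarith
  · refine Eventually.of_forall fun i x _ y _ hx hy hxy => ?_
    have hp : (0 : ℝ) < 2 ^ n := by positivity
    have hcell : cell n x = cell n y := by
      by_contra h
      obtain ⟨c, hc⟩ := exists_int_of_cell_ne h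
      rw [le_div_iff₀' hp] at hxy
      exact hx (Or.inr ⟨c, hc.trans hxy⟩)
    have h1 : |T.avg i (N i) (f i) x - T.avg i n (f i) x| ≤ ε / 2 :=
      not_lt.1 fun h => hx (Or.inl h)
    have h2 : |T.avg i (N i) (f i) y - T.avg i n (f i) y| ≤ ε / 2 :=
      not_lt.1 fun h => hy (Or.inl h)
    have h3 : T.avg i n (f i) x = T.avg i n (f i) y := by
      simp only [avg, condAvg, hcell]
    rw [h3] at h1
    rw [abs_le] at h1 h2 ⊢
    constructor <;> linarith [h1.1, h1.2, h2.1, h2.2]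

variable {T} in
theorem SmallTails.absolutelySIntegrable_self {f : I → ℝ → ℝ} (hf : T.SmallTails f) {C : ℝ}
    (hC : ∀ᶠ i in U, T.sum i (fun x => |f i x|) ≤ C) :
    T.AbsolutelySIntegrable (f : Ultrapower U (ℝ → ℝ)) := by
  refine hf.absolutelySIntegrable hC fun M hM => ?_
  filter_upwards [T.eventually_regular] with i hi A
  rw [← sum_const_mul, ← sum_add]
  refine hi.sum_mono fun x _ => ?_
  by_cases hA : x ∈ A <;> by_cases hx : M < |f i x| <;> simp [hA, hx] <;> linarith

variable {T} in
/-- Averaging preserves uniform integrability, since the average of `|f|` is at most `M` plus the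
average of the part of `|f|` above `M`, and averaging preserves integrals. -/
theorem SmallTails.absolutelySIntegrable_avg {f : I → ℝ → ℝ} (hf : T.SmallTails f) {C : ℝ}
    (hC : ∀ᶠ i in U, T.sum i (fun x => |f i x|) ≤ C) (N : I → ℕ) :
    T.AbsolutelySIntegrable
      ((fun i => T.avg i (N i) (f i) : I → ℝ → ℝ) : Ultrapower U (ℝ → ℝ)) := by
  refine hf.absolutelySIntegrable (C := C) ?_ fun M hM => ?_
  · filter_upwards [hC, T.eventually_regular] with i h1 h2
    exact (riemannSum_abs_condAvg_le h2.le _ _).trans h1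
  · filter_upwards [T.eventually_regular] with i hi A
    set tail : ℝ → ℝ := {x | M < |f i x|}.indicator fun x => |f i x| with htail
    have htail0 : ∀ x, 0 ≤ tail x := fun x => Set.indicator_nonneg (fun _ _ => abs_nonneg _) x
    have h1 : T.sum i tail = T.sum i (T.avg i (N i) tail) := (riemannSum_condAvg hi.le _ _).symm
    rw [h1, ← sum_const_mul, ← sum_add]
    have h2 : ∀ x, |f i x| ≤ M + tail x := fun x => by
      by_cases hx : M < |f i x|
      · rw [htail, Set.indicator_of_mem (by exact hx)]
        linarith
      · rw [htail, Set.indicator_of_notMem (by exact hx)]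
        linarith
    refine hi.sum_mono fun x _ => ?_
    have h3 : |T.avg i (N i) (f i) x| ≤ M + T.avg i (N i) tail x :=
      abs_condAvg_le hi.le (N i) hM.le h2 x
    have h4 : 0 ≤ T.avg i (N i) tail x := condAvg_nonneg hi.le (N i) htail0 x
    by_cases hA : x ∈ A
    · simpa [hA] using h3
    · simpa [hA] using h4

/-- A function can be truncated at an infinite level that grows so slowly that the truncation is
uniformly integrable. -/
theorem exists_smallTails_truncation {M : I → ℕ} (hM : Tendsto M U atTop) {f : I → ℝ → ℝ} {C : ℝ}
    (hC : ∀ᶠ i in U, T.sum i (fun x => |f i x|) ≤ C) :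
    ∃ N : I → ℕ, Tendsto N U atTop ∧
      T.SmallTails fun i => {x | |f i x| ≤ N i}.indicator (f i) := by
  obtain ⟨N, hN, hstab⟩ := exists_tendsto_forall_sub_le (U := U) hM (C := C)
    (x := fun n i => T.sum i ({x | (n : ℝ) < |f i x|}.indicator fun x => |f i x|)) fun n => by
      filter_upwards [hC, T.eventually_regular] with i h1 h2
      rw [abs_of_nonneg (h2.sum_nonneg fun x => Set.indicator_nonneg (fun _ _ => abs_nonneg _) x)]
      exact (h2.sum_mono fun x _ => Set.indicator_le_self' (fun _ _ => abs_nonneg _) x).trans h1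
  refine ⟨N, hN, fun ε hε => ?_⟩
  obtain ⟨n, hn⟩ := hstab ε hε
  refine ⟨n + 1, by positivity, ?_⟩
  filter_upwards [hn, T.eventually_regular, tendsto_atTop.1 hN n] with i h1 h2 h3
  rw [← sum_sub] at h1
  refine le_trans (h2.sum_mono fun x _ => ?_) h1
  have h3' : (n : ℝ) ≤ N i := by exact_mod_cast h3
  by_cases hx : |f i x| ≤ N i
  · have e : {x | |f i x| ≤ N i}.indicator (f i) x = f i x :=
      Set.indicator_of_mem (s := {x | |f i x| ≤ N i}) hx _
    have e2 : ({x | (N i : ℝ) < |f i x|}.indicator fun x => |f i x|) x = 0 :=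
      Set.indicator_of_notMem (by simpa using hx) _
    rw [e2, sub_zero]
    by_cases hxn : (n : ℝ) < |f i x|
    · rw [Set.indicator_of_mem (s := {x | (n : ℝ) < |f i x|}) (by exact hxn)]
      refine (Set.indicator_le_self' (fun _ _ => abs_nonneg _) x).trans ?_
      rw [e]
    · rw [Set.indicator_of_notMem]
      · exact Set.indicator_nonneg (fun _ _ => abs_nonneg _) x
      · simp only [Set.mem_ofPred_eq, e]
        linarith
  · have e : {x | |f i x| ≤ N i}.indicator (f i) x = 0 :=
      Set.indicator_of_notMem (s := {x | |f i x| ≤ N i}) hx _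
    rw [not_le] at hx
    rw [Set.indicator_of_mem (s := {x | (n : ℝ) < |f i x|}) (by exact h3'.trans_lt hx),
      Set.indicator_of_mem (s := {x | (N i : ℝ) < |f i x|}) (by exact hx), sub_self]
    refine (Set.indicator_le_self' (fun _ _ => abs_nonneg _) x).trans ?_
    rw [e, abs_zero]

/-- The part of `f` removed by a truncation at an infinite level vanishes outside an internal set
of infinitesimal measure. -/
theorem almostUniform_sub_truncation {f : I → ℝ → ℝ} {C : ℝ}
    (hC : ∀ᶠ i in U, T.sum i (fun x => |f i x|) ≤ C) {N : I → ℕ} (hN : Tendsto N U atTop) :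
    T.AlmostUniform fun i x => f i x - {x | |f i x| ≤ N i}.indicator (f i) x := by
  intro ε hε α hα
  refine ⟨fun i => {x | (N i : ℝ) < |f i x|}, ?_, 1, one_pos, ?_⟩
  · obtain ⟨n, hn⟩ := exists_nat_gt ((|C| + 1) / α)
    filter_upwards [hC, T.eventually_regular, tendsto_atTop.1 hN n] with i h1 h2 h3
    have h4 := h2.mul_sum_indicator_lt_le (f i) (N i)
    have h5 : (n : ℝ) ≤ N i := by exact_mod_cast h3
    have h6 : (|C| + 1) / α < N i := hn.trans_le h5
    have h7 : 0 < (|C| + 1) / α := by positivity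
    rw [div_lt_iff₀ hα] at h6
    refine le_of_mul_le_mul_left (a := (N i : ℝ)) ?_ (by linarith)
    linarith [le_abs_self C]
  · refine Eventually.of_forall fun i x _ y _ hx hy _ => ?_
    have e : ∀ x ∉ {x | (N i : ℝ) < |f i x|}, {x | |f i x| ≤ N i}.indicator (f i) x = f i x :=
      fun x hx => Set.indicator_of_mem (s := {x | |f i x| ≤ N i})
        (show |f i x| ≤ N i from not_lt.1 hx) _
    beta_reduce
    rw [e x hx, e y hy]
    simpa using hε.le

/-! ### Quickly fluctuating functions -/

variable {T} in
/-- If `A` is quadrable, then the cells of infinitesimal size that meet both `A` and its complement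
lie in the boundary of `A`, so they have infinitesimal total measure. The remaining part of `A` is
a union of cells. -/
theorem AbsolutelySIntegrable.quicklyFluctuating {M : I → ℕ} (hM : Tendsto M U atTop)
    {h : I → ℝ → ℝ} (hh : T.AbsolutelySIntegrable (h : Ultrapower U (ℝ → ℝ))) {N : I → ℕ}
    (hN : Tendsto N U atTop)
    (h0 : ∀ᶠ i in U, ∀ S : Set ℤ, T.sum i ((cell (N i) ⁻¹' S).indicator (h i)) = 0) :
    T.QuicklyFluctuating (h : Ultrapower U (ℝ → ℝ)) := by
  refine ⟨hh.sIntegrable, fun A hA => ?_⟩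
  induction A using Germ.inductionOn with | _ A => ?_
  rw [Quadrable, rare_iff] at hA
  let S : I → Set ℤ := fun i => {c | ∃ y ∈ T.pts i, y ∈ A i ∧ cell (N i) y = c}
  let S' : I → Set ℤ := fun i => {c | ∃ z ∈ T.pts i, z ∉ A i ∧ cell (N i) z = c}
  let D : I → Set ℝ := fun i => cell (N i) ⁻¹' (S i ∩ S' i)
  have hD : ∀ α > 0, ∀ᶠ i in U, T.sum i ((D i).indicator 1) ≤ α := by
    intro α hα
    obtain ⟨B, hB, hBm⟩ := hA α hα
    have hDB : ∀ᶠ i in U, ∀ x, x ∈ T.pts i ∧ x ∈ D i → x ∈ B i := by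
      refine eventually_forall_of_choice fun x => Ultrafilter.eventually_imp.2 fun hx => ?_
      obtain ⟨y, hy⟩ := (hx.mono fun i hi => hi.2.1).choice
      obtain ⟨z, hz⟩ := (hx.mono fun i hi => hi.2.2).choice
      have hclose : ∀ w : I → ℝ, (∀ᶠ i in U, cell (N i) (w i) = cell (N i) (x i)) →
          InfClose (x : Ultrapower U ℝ) w := by
        intro w hw
        refine infinitesimal_coe_of_le (x := fun i => x i - w i) fun ε hε => ?_
        obtain ⟨m, hm⟩ := exists_pow_lt_of_lt_one hε (one_half_lt_one (α := ℝ))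
        filter_upwards [hw, tendsto_atTop.1 hN m] with i h1 h2
        refine (abs_sub_le_of_cell_eq h1.symm).trans (le_trans ?_ hm.le)
        exact pow_le_pow_of_le_one (by norm_num) (by norm_num) h2
      refine hB x ⟨T.coe_mem_points.2 (hx.mono fun i hi => hi.1),
        ⟨y, T.coe_mem_points.2 (hy.mono fun i hi => hi.1),
          hclose y (hy.mono fun i hi => hi.2.2), hy.mono fun i hi => hi.2.1⟩,
        ⟨z, T.coe_mem_points.2 (hz.mono fun i hi => hi.1),
          hclose z (hz.mono fun i hi => hi.2.2), ?_⟩⟩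
      exact Ultrafilter.eventually_not.1 (hz.mono fun i hi => hi.2.1)
    filter_upwards [hDB, hBm, T.eventually_regular] with i h1 h2 h3
    exact (h3.sum_indicator_mono (fun _ => zero_le_one) fun x hx hxD => h1 x ⟨hx, hxD⟩).trans h2
  rw [integral_coe]
  refine infinitesimal_coe_of_le fun ε hε => ?_
  obtain ⟨δ, hδ, hsmall⟩ := hh.exists_delta hM hε
  filter_upwards [hsmall, hD δ hδ, h0, T.eventually_regular] with i h1 h2 h3 h4
  have e : T.sum i ((A i).indicator (h i)) = T.sum i fun x =>
      (cell (N i) ⁻¹' (S i \ S' i)).indicator (h i) x + (A i ∩ D i).indicator (h i) x := by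
    refine T.sum_congr fun x hx => ?_
    by_cases hxA : x ∈ A i
    · have hxS : cell (N i) x ∈ S i := ⟨x, hx, hxA, rfl⟩
      by_cases hxS' : cell (N i) x ∈ S' i
      · have hxD : x ∈ D i := ⟨hxS, hxS'⟩
        simp [hxA, hxS', hxD]
      · have hxD : x ∉ D i := fun h => hxS' h.2
        simp [hxA, hxS, hxS', hxD]
    · have hxS' : cell (N i) x ∈ S' i := ⟨x, hx, hxA, rfl⟩
      simp [hxA, hxS']
  rw [e, sum_add, h3, zero_add]
  refine (h4.abs_sum_le fun x _ => ?_).trans (h1 _ h2)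
  by_cases hxD : x ∈ D i <;> by_cases hxA : x ∈ A i <;> simp [hxA, hxD]

theorem Regular.sum_cell_sub_avg {T : NearInterval U a b} {i : I} (h : T.Regular i) (k : ℕ)
    (f : ℝ → ℝ) (S : Set ℤ) :
    T.sum i ((cell k ⁻¹' S).indicator fun x => f x - T.avg i k f x) = 0 := by
  have h1 := riemannSum_mul_condAvg h.le k f (S.indicator 1)
  have h2 : T.sum i (fun x => S.indicator 1 (cell k x) * f x -
      S.indicator 1 (cell k x) * T.avg i k f x) = 0 := by
    rw [sum_sub, sub_eq_zero]
    exact h1.symm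
  rw [← h2]
  refine T.sum_congr fun x _ => ?_
  by_cases hx : cell k x ∈ S <;> simp [hx]

variable {T} in
/-- Off a small set, the truncation of `u` at level `M` is close to a function `v` that is
constant on the cells of a standard level `k`. The sets `{v > 0}` and `{v < 0}` are quadrable, so
`u` has infinitesimal integral over them; hence `|v|`, and with it `|u|`, has small integral. -/
theorem AbsolutelySIntegrable.eventually_sum_abs_le_of_almostUniform {M : I → ℕ}
    (hM : Tendsto M U atTop) {u : I → ℝ → ℝ}
    (hu : T.AbsolutelySIntegrable (u : Ultrapower U (ℝ → ℝ))) (hcont : T.AlmostUniform u)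
    (hfl : ∀ A : Ultrapower U (Set ℝ), T.Quadrable A →
      Infinitesimal (T.integral A (u : Ultrapower U (ℝ → ℝ)))) {ε : ℝ} (hε : 0 < ε) :
    ∀ᶠ i in U, T.sum i (fun x => |u i x|) ≤ ε := by
  classical
  obtain ⟨r, hr, htail⟩ := hu.smallTails hM (ε / 8) (by positivity)
  have hη : 0 < ε / (8 * (|b - a| + 1)) := by positivity
  obtain ⟨B, hB, δ, hδ, hBu⟩ := hcont _ hη (ε / (16 * r)) (by positivity)
  obtain ⟨k, hk⟩ := exists_pow_lt_of_lt_one hδ (one_half_lt_one (α := ℝ))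
  -- the value of `v` on a cell is the truncated value of `u` at some point of the cell off `B`
  let w : I → ℤ → ℝ := fun i c =>
    if hc : ∃ y, y ∈ T.pts i ∧ y ∉ B i ∧ cell k y = c then max (-r) (min r (u i hc.choose)) else 0
  let v : I → ℝ → ℝ := fun i x => w i (cell k x)
  have hw : ∀ i c, |w i c| ≤ r := by
    intro i c
    simp only [w]
    split_ifs with hc
    · exact abs_le.2 ⟨le_max_left _ _, max_le (by linarith) (min_le_left _ _)⟩
    · simpa using hr.le
  have hpos := T.quadrable_preimage_cell k fun i => {c | 0 < w i c}
  have hneg := T.quadrable_preimage_cell k fun i => {c | w i c < 0}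
  have ipos := hfl _ hpos
  have ineg := hfl _ hneg
  rw [integral_coe, infinitesimal_coe] at ipos ineg
  filter_upwards [htail, hB, hBu, ipos (ε / 8) (by positivity), ineg (ε / 8) (by positivity),
    T.eventually_regular] with i h1 h2 h3 h4 h5 h6
  have hclose : ∀ x ∈ T.pts i, |u i x - v i x| ≤
      {x | r < |u i x|}.indicator (fun x => |u i x|) x +
        (ε / (8 * (|b - a| + 1)) + 2 * r * (B i).indicator 1 x) := by
    intro x hx
    have htr : |u i x - max (-r) (min r (u i x))| ≤
        {x | r < |u i x|}.indicator (fun x => |u i x|) x := by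
      by_cases hxr : r < |u i x|
      · rw [Set.indicator_of_mem (by exact hxr)]
        rcases abs_cases (u i x) with ⟨e1, e2⟩ | ⟨e1, e2⟩
        · rw [min_eq_left (by linarith), max_eq_right (by linarith), abs_of_nonneg (by linarith)]
          linarith
        · rw [min_eq_right (by linarith), max_eq_left (by linarith), abs_of_nonpos (by linarith)]
          linarith
      · rw [Set.indicator_of_notMem (by exact hxr)]
        obtain ⟨e1, e2⟩ := abs_le.1 (not_lt.1 hxr)
        rw [min_eq_right e2, max_eq_right e1, sub_self, abs_zero]
    have hv : |max (-r) (min r (u i x)) - v i x| ≤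
        ε / (8 * (|b - a| + 1)) + 2 * r * (B i).indicator 1 x := by
      by_cases hxB : x ∈ B i
      · rw [Set.indicator_of_mem hxB, Pi.one_apply, mul_one]
        have e1 : |max (-r) (min r (u i x))| ≤ r :=
          abs_le.2 ⟨le_max_left _ _, max_le (by linarith) (min_le_left _ _)⟩
        have e2 := hw i (cell k x)
        have e3 := abs_sub (max (-r) (min r (u i x))) (v i x)
        change |v i x| ≤ r at e2
        linarith
      · have hc : ∃ y, y ∈ T.pts i ∧ y ∉ B i ∧ cell k y = cell k x := ⟨x, hx, hxB, rfl⟩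
        have ev : v i x = max (-r) (min r (u i hc.choose)) := dif_pos hc
        obtain ⟨e1, e2, e3⟩ := hc.choose_spec
        rw [ev, Set.indicator_of_notMem hxB, mul_zero, add_zero]
        have e4 := abs_max_sub_max_le_max (-r) (min r (u i x)) (-r) (min r (u i hc.choose))
        have e5 := abs_min_sub_min_le_max r (u i x) r (u i hc.choose)
        simp only [sub_self, abs_zero, abs_nonneg, sup_of_le_right] at e4 e5
        refine (e4.trans e5).trans (h3 x hx _ e1 hxB e2
          ((abs_sub_le_of_cell_eq e3.symm).trans hk.le))
    linarith [abs_sub_le (u i x) (max (-r) (min r (u i x))) (v i x)]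
  have h7 := h6.sum_mono hclose
  rw [sum_add, sum_add, sum_const_mul, h6.sum_const] at h7
  have h8 : ε / (8 * (|b - a| + 1)) * (b - a) ≤ ε / 8 := by
    rw [div_mul_eq_mul_div, div_le_div_iff₀ (by positivity) (by positivity)]
    nlinarith [le_abs_self (b - a)]
  have h9 : 2 * r * T.sum i ((B i).indicator 1) ≤ ε / 8 := by
    rw [le_div_iff₀ (by positivity)] at h2
    linarith
  have h10 : T.sum i (fun x => |u i x|) ≤ T.sum i fun x => 2 * |u i x - v i x| +
      ((cell k ⁻¹' {c | 0 < w i c}).indicator (u i) x -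
        (cell k ⁻¹' {c | w i c < 0}).indicator (u i) x) := by
    refine h6.sum_mono fun x _ => ?_
    rcases lt_trichotomy (v i x) 0 with hx | hx | hx
    · rw [Set.indicator_of_notMem (show x ∉ cell k ⁻¹' {c | 0 < w i c} from hx.not_gt),
        Set.indicator_of_mem (show x ∈ cell k ⁻¹' {c | w i c < 0} from hx)]
      cases abs_cases (u i x) <;> cases abs_cases (u i x - v i x) <;> linarith
    · rw [Set.indicator_of_notMem (show x ∉ cell k ⁻¹' {c | 0 < w i c} from hx.not_gt),
        Set.indicator_of_notMem (show x ∉ cell k ⁻¹' {c | w i c < 0} from hx.not_lt), hx]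
      simp only [sub_zero, add_zero]
      linarith [abs_nonneg (u i x)]
    · rw [Set.indicator_of_mem (show x ∈ cell k ⁻¹' {c | 0 < w i c} from hx),
        Set.indicator_of_notMem (show x ∉ cell k ⁻¹' {c | w i c < 0} from hx.not_gt)]
      cases abs_cases (u i x) <;> cases abs_cases (u i x - v i x) <;> linarith
  rw [sum_add, sum_sub, sum_const_mul] at h10
  linarith [le_abs_self (T.sum i ((cell k ⁻¹' {c | 0 < w i c}).indicator (u i))),
    neg_abs_le (T.sum i ((cell k ⁻¹' {c | w i c < 0}).indicator (u i)))]

variable {T}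

/-! ### Existence and uniqueness of the decomposition -/

/-- Over a near interval reduced to a point every integral vanishes. -/
theorem integral_eq_zero_of_len (h : ∀ᶠ i in U, T.len i = 0) (A : Ultrapower U (Set ℝ))
    (f : Ultrapower U (ℝ → ℝ)) : T.integral A f = 0 := by
  induction A using Germ.inductionOn with | _ A => ?_
  induction f using Germ.inductionOn with | _ f => ?_
  rw [integral_coe]
  refine Germ.coe_eq.2 (h.mono fun i hi => ?_)
  simp [sum, riemannSum, hi]

theorem infinitesimal_integral_of_len (h : ∀ᶠ i in U, T.len i = 0) (A : Ultrapower U (Set ℝ))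
    (f : Ultrapower U (ℝ → ℝ)) : Infinitesimal (T.integral A f) := by
  rw [integral_eq_zero_of_len h]
  exact infinitesimal_coe_of_le (x := 0) fun ε hε =>
    Eventually.of_forall fun i => by simpa using hε.le

theorem limited_integral_of_len (h : ∀ᶠ i in U, T.len i = 0) (A : Ultrapower U (Set ℝ))
    (f : Ultrapower U (ℝ → ℝ)) : Limited (T.integral A f) := by
  rw [integral_eq_zero_of_len h]
  exact limited_coe (x := 0) |>.2 ⟨0, Eventually.of_forall fun i => by simp⟩

theorem rare_of_len (h : ∀ᶠ i in U, T.len i = 0) (R : Set (Ultrapower U ℝ)) : T.Rare R := by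
  refine T.rare_iff.2 fun α hα => ⟨fun _ => Set.univ, fun x _ => ?_, h.mono fun i hi => ?_⟩
  · induction x using Germ.inductionOn with | _ x => ?_
    exact Eventually.of_forall fun i => Set.mem_univ _
  · simpa [sum, riemannSum, hi] using hα.le

/-- The part of `f` above a suitable infinite level belongs to the trend, because it lives on a set
of infinitesimal measure. The rest `f₁` is uniformly integrable; its trend is its average over
infinitesimal cells. -/
theorem exists_isDecomposition {M : I → ℕ} (hM : Tendsto M U atTop) (f : I → ℝ → ℝ)
    (hf : T.SIntegrable (f : Ultrapower U (ℝ → ℝ))) :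
    ∃ g h : Ultrapower U (ℝ → ℝ), T.IsDecomposition f g h ∧
      (T.AbsolutelySIntegrable (f : Ultrapower U (ℝ → ℝ)) →
        T.AbsolutelySIntegrable g ∧ T.AbsolutelySIntegrable h) := by
  obtain ⟨C, hC⟩ := hf.eventually_sum_abs_le
  obtain ⟨K, hK, htail⟩ := T.exists_smallTails_truncation hM hC
  set f₁ : I → ℝ → ℝ := fun i => {x | |f i x| ≤ K i}.indicator (f i) with hf₁
  have hle : ∀ i x, |f₁ i x| ≤ |f i x| ∧ |f i x - f₁ i x| ≤ |f i x| := by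
    intro i x
    by_cases hx : x ∈ {x | |f i x| ≤ K i}
    · simp only [hf₁, Set.indicator_of_mem hx, sub_self, abs_zero]
      exact ⟨le_rfl, abs_nonneg _⟩
    · simp only [hf₁, Set.indicator_of_notMem hx, sub_zero, abs_zero]
      exact ⟨abs_nonneg _, le_rfl⟩
  have hC₁ : ∀ᶠ i in U, T.sum i (fun x => |f₁ i x|) ≤ C := by
    filter_upwards [hC, T.eventually_regular] with i h1 h2
    exact (h2.sum_mono fun x _ => (hle i x).1).trans h1
  obtain ⟨N, hN, hcont⟩ := T.exists_almostUniform_avg hM hC₁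
  have hf₁abs := htail.absolutelySIntegrable_self hC₁
  have havg := htail.absolutelySIntegrable_avg hC₁ N
  have hhabs : T.AbsolutelySIntegrable
      ((fun i x => f₁ i x - T.avg i (N i) (f₁ i) x : I → ℝ → ℝ) : Ultrapower U (ℝ → ℝ)) :=
    hf₁abs.of_le havg (Eventually.of_forall fun i x _ => abs_sub _ _)
  have hgle : ∀ i x, |T.avg i (N i) (f₁ i) x + (f i x - f₁ i x)| ≤
      |T.avg i (N i) (f₁ i) x| + |f i x| := fun i x =>
    (abs_add_le _ _).trans (add_le_add_right (hle i x).2 _)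
  refine ⟨((fun i x => T.avg i (N i) (f₁ i) x + (f i x - f₁ i x) : I → ℝ → ℝ) :),
    ((fun i x => f₁ i x - T.avg i (N i) (f₁ i) x : I → ℝ → ℝ) :), ⟨?_, ⟨?_, ?_⟩, ?_⟩,
    fun hfabs => ⟨?_, hhabs⟩⟩
  · intro x _
    induction x using Germ.inductionOn with | _ x => ?_
    refine Germ.coe_eq.2 (Eventually.of_forall fun i => ?_)
    change f i (x i) = (T.avg i (N i) (f₁ i) (x i) + (f i (x i) - f₁ i (x i))) +
      (f₁ i (x i) - T.avg i (N i) (f₁ i) (x i))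
    ring
  · exact havg.sIntegrable.of_le hf (Eventually.of_forall fun i x _ => hgle i x)
  · exact (hcont.add (T.almostUniform_sub_truncation hC hK)).almostContinuous hM
  · exact hhabs.quicklyFluctuating hM hN
      (T.eventually_regular.mono fun i hi S => hi.sum_cell_sub_avg (N i) (f₁ i) S)
  · exact havg.of_le hfabs (Eventually.of_forall fun i x _ => hgle i x)

/-- A function whose absolute value has infinitesimal integral `η` is infinitesimal outside the
internal set where its absolute value exceeds `√η`. -/
theorem exists_rare_of_infinitesimal_sum {u : I → ℝ → ℝ}
    (hu : ∀ ε > 0, ∀ᶠ i in U, T.sum i (fun x => |u i x|) ≤ ε) :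
    ∃ R ⊆ T.points, T.Rare R ∧ ∀ x : I → ℝ, (x : Ultrapower U ℝ) ∈ T.points \ R →
      ∀ ε > 0, ∀ᶠ i in U, |u i (x i)| ≤ ε := by
  set η : I → ℝ := fun i => T.sum i fun x => |u i x| with hη
  set B : I → Set ℝ := fun i => {x | √(η i) < |u i x|} with hB
  have hsqrt : ∀ ε > 0, ∀ᶠ i in U, √(η i) ≤ ε := fun ε hε =>
    (hu (ε ^ 2) (by positivity)).mono fun i hi => (Real.sqrt_le_left hε.le).2 hi
  refine ⟨{x | x ∈ T.points ∧ InternalMem x (B : Ultrapower U (Set ℝ))}, fun x hx => hx.1,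
    T.rare_iff.2 fun α hα => ⟨B, fun x hx => hx.2, ?_⟩, ?_⟩
  · filter_upwards [hsqrt α hα, T.eventually_regular] with i h1 h2
    refine le_trans ?_ h1
    have h3 : 0 ≤ η i := h2.sum_nonneg fun _ => abs_nonneg _
    have h4 : √(η i) * T.sum i ((B i).indicator 1) ≤ η i := h2.mul_sum_indicator_lt_le (u i) _
    rcases h3.eq_or_lt with h5 | h5
    -- if `η = 0`, then `u` vanishes at every point of positive weight
    · have h6 : T.sum i ((B i).indicator 1) = 0 := by
        have h7 := (Finset.sum_eq_zero_iff_of_nonneg fun j hj =>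
          mul_nonneg (abs_nonneg (u i (T.node i j)))
            (sub_nonneg.2 (h2.le j (Finset.mem_range.1 hj)))).1 h5.symm
        unfold sum riemannSum
        refine Finset.sum_eq_zero fun j hj => ?_
        rcases mul_eq_zero.1 (h7 j hj) with h8 | h8
        · rw [Set.indicator_of_notMem, zero_mul]
          simp only [hB, Set.mem_ofPred_eq, h8, not_lt]
          exact Real.sqrt_nonneg _
        · rw [h8, mul_zero]
      rw [h6]
      exact Real.sqrt_nonneg _
    · refine le_of_mul_le_mul_left (a := √(η i)) ?_ (Real.sqrt_pos.2 h5)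
      rwa [Real.mul_self_sqrt h3]
  · rintro x ⟨hx, hxR⟩ ε hε
    have hxB : ∀ᶠ i in U, ¬ x i ∈ B i := Ultrafilter.eventually_not.2 fun h => hxR ⟨hx, h⟩
    filter_upwards [hxB, hsqrt ε hε] with i h1 h2
    exact (not_lt.1 h1).trans h2

/-- The difference of two trends is almost continuous, absolutely `S`-integrable, and, as the
opposite of the difference of the fluctuations, of infinitesimal integral over quadrable sets. -/
theorem decomposition_unique {M : I → ℕ} (hM : Tendsto M U atTop) {f g h g' h' : I → ℝ → ℝ}
    (hd : T.IsDecomposition (f : Ultrapower U (ℝ → ℝ)) g h)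
    (hd' : T.IsDecomposition (f : Ultrapower U (ℝ → ℝ)) g' h')
    (hg : T.AbsolutelySIntegrable (g : Ultrapower U (ℝ → ℝ)))
    (hg' : T.AbsolutelySIntegrable (g' : Ultrapower U (ℝ → ℝ))) :
    (∃ R ⊆ T.points, T.Rare R ∧ ∀ x ∈ T.points \ R,
      InfClose (app (g : Ultrapower U (ℝ → ℝ)) x) (app (g' : Ultrapower U (ℝ → ℝ)) x) ∧
      InfClose (app (h : Ultrapower U (ℝ → ℝ)) x) (app (h' : Ultrapower U (ℝ → ℝ)) x)) ∧
    Infinitesimal (T.totalIntegral (absFun ((g : Ultrapower U (ℝ → ℝ)) - g'))) ∧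
    Infinitesimal (T.totalIntegral (absFun ((h : Ultrapower U (ℝ → ℝ)) - h'))) := by
  have hpts : ∀ {k k' : I → ℝ → ℝ}, T.IsDecomposition (f : Ultrapower U (ℝ → ℝ)) k k' →
      ∀ᶠ i in U, ∀ x, x ∈ T.pts i → f i x = k i x + k' i x := fun {k k'} hk =>
    eventually_forall_of_choice fun x => Ultrafilter.eventually_imp.2 fun hx =>
      Germ.coe_eq.1 (hk.1 x (T.coe_mem_points.2 hx))
  have heq : ∀ᶠ i in U, ∀ x ∈ T.pts i, g i x - g' i x = h' i x - h i x := by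
    filter_upwards [hpts hd, hpts hd'] with i h1 h2 x hx
    linarith [h1 x hx, h2 x hx]
  set u : I → ℝ → ℝ := fun i x => g i x + -g' i x with hu
  have huabs : T.AbsolutelySIntegrable (u : Ultrapower U (ℝ → ℝ)) :=
    hg.of_le hg' (Eventually.of_forall fun i x _ => by
      simpa only [hu, abs_neg] using abs_add_le (g i x) (-g' i x))
  have hneg : T.AlmostUniform fun i x => -g' i x := by
    intro ε hε α hα
    obtain ⟨B, hB, δ, hδ, hBu⟩ := hd'.2.1.2.almostUniform hM ε hε α hα
    refine ⟨B, hB, δ, hδ, hBu.mono fun i hi x hx y hy hxB hyB hxy => ?_⟩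
    rw [neg_sub_neg, abs_sub_comm]
    exact hi x hx y hy hxB hyB hxy
  have hucont : T.AlmostUniform u := (hd.2.1.2.almostUniform hM).add hneg
  have hfl : ∀ A : Ultrapower U (Set ℝ), T.Quadrable A →
      Infinitesimal (T.integral A (u : Ultrapower U (ℝ → ℝ))) := by
    intro A hA
    have i1 := hd.2.2.2 A hA
    have i2 := hd'.2.2.2 A hA
    induction A using Germ.inductionOn with | _ A => ?_
    rw [integral_coe, infinitesimal_coe] at i1 i2
    rw [integral_coe]
    refine infinitesimal_coe_of_le fun ε hε => ?_
    filter_upwards [i1 _ (half_pos hε), i2 _ (half_pos hε), heq] with i h1 h2 h3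
    have e : T.sum i ((A i).indicator (u i)) =
        T.sum i ((A i).indicator (h' i)) - T.sum i ((A i).indicator (h i)) := by
      rw [← sum_sub]
      refine T.sum_congr fun x hx => ?_
      by_cases hxA : x ∈ A i
      · simp only [Set.indicator_of_mem hxA, hu, ← h3 x hx]
        ring
      · simp [hxA]
    rw [e]
    linarith [abs_sub (T.sum i ((A i).indicator (h' i))) (T.sum i ((A i).indicator (h i)))]
  have hsmall : ∀ ε > 0, ∀ᶠ i in U, T.sum i (fun x => |u i x|) ≤ ε := fun ε hε =>
    huabs.eventually_sum_abs_le_of_almostUniform hM hucont hfl hε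
  have htotal : ∀ k : I → ℝ → ℝ, (∀ᶠ i in U, ∀ x ∈ T.pts i, |k i x| = |u i x|) →
      Infinitesimal (T.totalIntegral (absFun (k : Ultrapower U (ℝ → ℝ)))) := by
    intro k hk
    rw [show absFun (k : Ultrapower U (ℝ → ℝ)) = ((fun i x => |k i x| : I → ℝ → ℝ) :) from rfl,
      totalIntegral_coe]
    refine infinitesimal_coe_of_le fun ε hε => ?_
    filter_upwards [hsmall ε hε, hk, T.eventually_regular] with i h1 h2 h3
    rw [abs_of_nonneg (h3.sum_nonneg fun _ => abs_nonneg _), T.sum_congr h2]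
    exact h1
  have hgu : ∀ᶠ i in U, ∀ x ∈ T.pts i, |g i x - g' i x| = |u i x| :=
    Eventually.of_forall fun i x _ => by rw [hu, sub_eq_add_neg]
  have hhu : ∀ᶠ i in U, ∀ x ∈ T.pts i, |h i x - h' i x| = |u i x| := by
    filter_upwards [hgu, heq] with i h1 h2 x hx
    rw [← h1 x hx, h2 x hx, abs_sub_comm]
  obtain ⟨R, hRT, hR, hRu⟩ := exists_rare_of_infinitesimal_sum hsmall
  refine ⟨⟨R, hRT, hR, fun x hx => ?_⟩, htotal (fun i x => g i x - g' i x) hgu,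
    htotal (fun i x => h i x - h' i x) hhu⟩
  induction x using Germ.inductionOn with | _ x => ?_
  have hxT := T.coe_mem_points.1 hx.1
  constructor
  · refine infinitesimal_coe_of_le (x := fun i => g i (x i) - g' i (x i)) fun ε hε => ?_
    filter_upwards [hgu, hxT, hRu x hx ε hε] with i h1 h2 h3
    rwa [h1 _ h2]
  · refine infinitesimal_coe_of_le (x := fun i => h i (x i) - h' i (x i)) fun ε hε => ?_
    filter_upwards [hhu, hxT, hRu x hx ε hε] with i h1 h2 h3
    rwa [h1 _ h2]

end NearInterval

end CartierPerrin

end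

theorem theorem1 {I : Type*} (U : Ultrafilter I) (a b : ℝ)
    (T : CartierPerrin.NearInterval U a b)
    (f : CartierPerrin.Ultrapower U (ℝ → ℝ)) (hf : T.SIntegrable f) :
    (∃ g h : CartierPerrin.Ultrapower U (ℝ → ℝ), T.IsDecomposition f g h ∧
      (T.AbsolutelySIntegrable f → T.AbsolutelySIntegrable g ∧ T.AbsolutelySIntegrable h)) ∧
    (∀ g h g' h' : CartierPerrin.Ultrapower U (ℝ → ℝ),
      T.IsDecomposition f g h → T.IsDecomposition f g' h' →
      T.AbsolutelySIntegrable g → T.AbsolutelySIntegrable g' →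
        (∃ R ⊆ T.points, T.Rare R ∧ ∀ x ∈ T.points \ R,
          CartierPerrin.InfClose (CartierPerrin.app g x) (CartierPerrin.app g' x) ∧
          CartierPerrin.InfClose (CartierPerrin.app h x) (CartierPerrin.app h' x)) ∧
        CartierPerrin.Infinitesimal (T.totalIntegral (CartierPerrin.absFun (g - g'))) ∧
        CartierPerrin.Infinitesimal (T.totalIntegral (CartierPerrin.absFun (h - h')))) := by
  rcases T.eventually_len_eq_zero_or with h0 | ⟨M, hM⟩
  -- the near interval is a single point: all integrals vanish and every set is rare
  · have hinf := CartierPerrin.NearInterval.infinitesimal_integral_of_len h0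
    have hlim := CartierPerrin.NearInterval.limited_integral_of_len h0
    have hrare := CartierPerrin.NearInterval.rare_of_len h0 T.points
    have habs : ∀ k, T.AbsolutelySIntegrable k := fun k => ⟨hlim _ _, fun _ _ => hinf _ _⟩
    have hS : ∀ k, T.SIntegrable k := fun k _ _ _ _ _ => ⟨hlim _ _, fun _ => hinf _ _⟩
    refine ⟨⟨f, ((fun _ _ => 0 : I → ℝ → ℝ) :), ⟨fun x _ => ?_,
      ⟨hS f, T.points, subset_rfl, hrare, fun x hx => absurd hx.1 hx.2⟩,
      hS _, fun _ _ => hinf _ _⟩, fun _ => ⟨habs _, habs _⟩⟩,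
      fun g h g' h' _ _ _ _ => ⟨⟨T.points, subset_rfl, hrare, fun x hx => absurd hx.1 hx.2⟩,
        hinf _ _, hinf _ _⟩⟩
    induction x using Filter.Germ.inductionOn with | _ x => ?_
    exact (add_zero _).symm
  · induction f using Filter.Germ.inductionOn with | _ f => ?_
    refine ⟨CartierPerrin.NearInterval.exists_isDecomposition hM f hf, fun g h g' h' => ?_⟩
    induction g using Filter.Germ.inductionOn with | _ g => ?_
    induction h using Filter.Germ.inductionOn with | _ h => ?_
    induction g' using Filter.Germ.inductionOn with | _ g' => ?_
    induction h' using Filter.Germ.inductionOn with | _ h' => ?_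
    exact CartierPerrin.NearInterval.decomposition_unique hM
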